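/- Let $\mathcal P=\{P_\theta\mid\theta\in\Theta\}$, $\Theta\subset\mathbb R$ open, be a family of probabilities on a measurable space $\Omega$ that is mean square differentiable at $\theta_0\in\Theta$ with scores function $\Lambda\in L_2=L_2(P)$, $P=P_{\theta_0}$; that is, $\sqrt{dP_{\theta_0+t}}=(1+\tfrac12 t\Lambda)\sqrt{dP}+o(t)$ as $t\to0$ in the Hilbert space of square roots of measures. Let $\mathrm E$, $\langle\cdot|\cdot\rangle$ and $\|\cdot\|$ denote expectation under $P$ and the inner product and norm of $L_2$, and put $\mathcal I=\|\Lambda\|^2$. For every tangent $\rho\in L_2$ with $\mathrm E\rho=0$ let $(P_{n,\rho})_n$ be a sequence of probabilities such that $\sqrt{dP_{n,\rho}}=(1+\tfrac1{2\sqrt n}\rho)\sqrt{dP}+o(1/\sqrt n)$. Let $r_0,r_1,\tau\in[0,\infty)$, $r=r_0+r_1$, $G_h=\{g\in L_2\mid \mathrm Eg=0,\ \mathrm Eg^2\le 8\}$, $G_{h,0}=r_0G_h$ and $G_{h,1}=\tau\Lambda+r_1G_h$. A pair $(g_0,g_1)\in G_{h,0}\times G_{h,1}$ is called a least favorable tangent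 pair if $g_1-g_0$ has minimum norm in $G_{h,1}-G_{h,0}$. Let $\alpha\in(0,1)$, and let $u_\alpha$ be the standard normal upper $\alpha$ point, $\Phi(-u_\alpha)=\alpha$. A sequence $\delta=(\delta_n)$ of measurable functions $\delta_n:\Omega^n\to[0,1]$ is called a maxmin asymptotic level $\alpha$ test if it maximizes the asymptotic minimum power $\inf_{g_1\in G_{h,1}}\liminf_{n}\int\delta_n\,dP_{n,g_1}^n$ among all such sequences subject to $\sup_{g_0\in G_{h,0}}\limsup_{n}\int\delta_n\,dP_{n,g_0}^n\le\alpha$. For a tangent pair $g=(g_0,g_1)$ with difference $g_{10}=g_1-g_0$ let $\delta_{n,g}=\mathbf I\bigl(\tfrac1{\sqrt n}\sum_{i=1}^n g_{10}(x_i)>\|g_{10}\|u_\alpha+\langle g_{10}|g_0\rangle\bigr)$. Assume $8r^2<\tau^2\mathcal I$. Then the least favorable tangent pair $q_h=(q_{h,0},q_{h,1})$ in $G_{h,0}\times G_{h,1}$ exists and is unique, namely $$q_{h,0}=r_0\gamma\Lambda,\qquad q_{h,1}=\tau\Lambda-r_1\gamma\Lambda,\qquad \gamma=\sqrt8\,\|\Lambda\|^{-1}.$$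 The test sequence $\delta_{q_h}=(\delta_{n,q_h})$ is a maxmin asymptotic level $\alpha$ test; it is given, $P^n$-almost surely for every $n$, by $$\delta_{n,q_h}=\mathbf I\Bigl(\frac1{\sqrt{n\mathcal I}}\sum_{i=1}^n\Lambda(x_i)>u_\alpha+\sqrt8\,r_0\Bigr),$$ the test defined by the right-hand side is itself maxmin, and both achieve the maxmin asymptotic power $\Phi(-u_\alpha+\tau\|\Lambda\|-\sqrt8\,r)$. Every other maxmin asymptotic level $\alpha$ test differs from this one only by terms tending to $0$ in $P^n$ probability. -/

import Mathlib

open MeasureTheory ProbabilityTheory Filter Topology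
open scoped ENNReal

noncomputable section

namespace TangentTests

variable {Ω : Type*} [MeasurableSpace Ω]

/-- The squared norm of `√dQ - (1 + s ρ / 2) √dP` in the Hilbert space of square roots of
measures. It is computed with densities with respect to `P + Q`; as usual, the value does not
depend on the choice of the dominating measure. The part of `Q` that is singular with respect
to `P` is included. -/
def sqrtDefect (P Q : ProbabilityMeasure Ω) (ρ : Ω → ℝ) (s : ℝ) : ℝ≥0∞ :=
  let μ : Measure Ω := (P : Measure Ω) + (Q : Measure Ω)
  ∫⁻ x, ENNReal.ofReal
    ((√((Q : Measure Ω).rnDeriv μ x).toReal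
        - (1 + 1 / 2 * s * ρ x) * √((P : Measure Ω).rnDeriv μ x).toReal) ^ 2) ∂μ

/-- `Λ` is (a measurable version of) the scores function at `θ₀` of the one parameter model
`M = {P_θ | θ ∈ Θ}`: it is square integrable under `P_{θ₀}`, and
`√dP_{θ₀ + t} = (1 + t Λ / 2) √dP_{θ₀} + o(t)` as `t → 0`. -/
structure IsScore {Θ : Set ℝ} (M : Θ → ProbabilityMeasure Ω) (θ₀ : Θ) (Λ : Ω → ℝ) : Prop where
  measurable : Measurable Λ
  memLp : MemLp Λ 2 (M θ₀ : Measure Ω)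
  tendsto : Tendsto
    (fun θ : Θ => sqrtDefect (M θ₀) (M θ) Λ ((θ : ℝ) - θ₀)
      / ENNReal.ofReal (((θ : ℝ) - θ₀) ^ 2)) (𝓝[≠] θ₀) (𝓝 0)

/-- The scores function as an element of `L₂(P_{θ₀})`. -/
def IsScore.toL2 {Θ : Set ℝ} {M : Θ → ProbabilityMeasure Ω} {θ₀ : Θ} {Λ : Ω → ℝ}
    (h : IsScore M θ₀ Λ) : Lp ℝ 2 (M θ₀ : Measure Ω) :=
  h.memLp.toLp Λ

/-- The sequence `Q_n` consists of local alternatives of `P` with tangent `ρ`: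
`√dQ_n = (1 + s_n ρ / 2) √dP + o(s_n)`, where `s_n = 1 / √n`. -/
def IsLocalAlternative (P : ProbabilityMeasure Ω) (ρ : Lp ℝ 2 (P : Measure Ω))
    (Q : ℕ → ProbabilityMeasure Ω) : Prop :=
  Tendsto (fun n : ℕ => (n : ℝ≥0∞) * sqrtDefect P (Q n) ρ (1 / √(n : ℝ))) atTop (𝓝 0)

/-- Asymptotic tests: sequences of (possibly randomized) tests at sample size `n`. -/
structure IsAsymptoticTest (δ : ∀ n : ℕ, (Fin n → Ω) → ℝ) : Prop where
  measurable : ∀ n, Measurable (δ n)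
  mem_Icc : ∀ n x, δ n x ∈ Set.Icc (0 : ℝ) 1

/-- The `n` fold product measure `Q^n`. -/
def iid (Q : ProbabilityMeasure Ω) (n : ℕ) : Measure (Fin n → Ω) :=
  Measure.pi fun _ => (Q : Measure Ω)

section Testing

variable {P : ProbabilityMeasure Ω}

/-- The asymptotic maximum size `sup_{g ∈ G} limsup_n ∫ δ_n dP_{n,g}^n`. -/
def asympSize (Pn : Lp ℝ 2 (P : Measure Ω) → ℕ → ProbabilityMeasure Ω)
    (G : Set (Lp ℝ 2 (P : Measure Ω))) (δ : ∀ n : ℕ, (Fin n → Ω) → ℝ) : ℝ :=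
  ⨆ g : G, limsup (fun n : ℕ => ∫ x, δ n x ∂(iid (Pn g n) n)) atTop

/-- The asymptotic minimum power `inf_{g ∈ G} liminf_n ∫ δ_n dP_{n,g}^n`. -/
def asympPower (Pn : Lp ℝ 2 (P : Measure Ω) → ℕ → ProbabilityMeasure Ω)
    (G : Set (Lp ℝ 2 (P : Measure Ω))) (δ : ∀ n : ℕ, (Fin n → Ω) → ℝ) : ℝ :=
  ⨅ g : G, liminf (fun n : ℕ => ∫ x, δ n x ∂(iid (Pn g n) n)) atTop

/-- `δ` is a maxmin asymptotic level `α` test for the hypothesis with tangents `G₀` versus the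
alternative with tangents `G₁`. -/
structure IsMaxminTest (Pn : Lp ℝ 2 (P : Measure Ω) → ℕ → ProbabilityMeasure Ω)
    (G₀ G₁ : Set (Lp ℝ 2 (P : Measure Ω))) (α : ℝ) (δ : ∀ n : ℕ, (Fin n → Ω) → ℝ) : Prop where
  isTest : IsAsymptoticTest δ
  level : asympSize Pn G₀ δ ≤ α
  maximal : ∀ δ' : ∀ n : ℕ, (Fin n → Ω) → ℝ, IsAsymptoticTest δ' →
    asympSize Pn G₀ δ' ≤ α → asympPower Pn G₁ δ' ≤ asympPower Pn G₁ δ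

/-- Least favorable tangent pairs: the difference has minimum norm in `G₁ - G₀`. -/
def IsLeastFavorable (G₀ G₁ : Set (Lp ℝ 2 (P : Measure Ω)))
    (g : Lp ℝ 2 (P : Measure Ω) × Lp ℝ 2 (P : Measure Ω)) : Prop :=
  g.1 ∈ G₀ ∧ g.2 ∈ G₁ ∧ ∀ h₀ ∈ G₀, ∀ h₁ ∈ G₁, ‖g.2 - g.1‖ ≤ ‖h₁ - h₀‖

/-- The Neyman-Pearson test sequence `δ_g` of a tangent pair `g = (g₀, g₁)`, with `u` the upper
`α` point of the standard normal distribution: it rejects when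
`n^{-1/2} ∑ g₁₀(x_i) > ‖g₁₀‖ u + ⟨g₁₀ | g₀⟩`, where `g₁₀ = g₁ - g₀`. -/
def pairTest (u : ℝ) (g : Lp ℝ 2 (P : Measure Ω) × Lp ℝ 2 (P : Measure Ω))
    (n : ℕ) (x : Fin n → Ω) : ℝ :=
  if 1 / √(n : ℝ) * ∑ i, (g.2 - g.1 : Lp ℝ 2 (P : Measure Ω)) (x i)
      > ‖g.2 - g.1‖ * u + inner ℝ (g.2 - g.1) g.1 then 1 else 0

end Testing

/-- The normed Hellinger tangent ball. -/
def hellingerBall (P : ProbabilityMeasure Ω) : Set (Lp ℝ 2 (P : Measure Ω)) :=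
  {g | ∫ x, g x ∂(P : Measure Ω) = 0 ∧ ∫ x, g x ^ 2 ∂(P : Measure Ω) ≤ 8}

/-- The tangent set `r₀ G_h` of the hypothesis. -/
def hellingerNull (P : ProbabilityMeasure Ω) (r₀ : ℝ) : Set (Lp ℝ 2 (P : Measure Ω)) :=
  (fun g => r₀ • g) '' hellingerBall P

/-- The tangent set `τ Λ + r₁ G_h` of the alternative. -/
def hellingerAlt (P : ProbabilityMeasure Ω) (Λ : Lp ℝ 2 (P : Measure Ω)) (τ r₁ : ℝ) :
    Set (Lp ℝ 2 (P : Measure Ω)) :=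
  (fun g => τ • Λ + r₁ • g) '' hellingerBall P

/-- The test sequence `𝐈(∑ Λ(x_i) / √(n I) > u + √8 r₀)`. -/
def scoreTest (Λ : Ω → ℝ) (I u r₀ : ℝ) (n : ℕ) (x : Fin n → Ω) : ℝ :=
  if 1 / √(n * I) * ∑ i, Λ (x i) > u + √8 * r₀ then 1 else 0

end TangentTests

end

open TangentTests

noncomputable section

namespace TangentTests

variable {Ω : Type*} [MeasurableSpace Ω]

/-! A tangent `g` matters only through its projection on the unit score `e = Λ / ‖Λ‖`. Under the
local alternatives with tangent `g` the standardized sum of `e` is asymptotically normal with mean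
`⟨g|e⟩` and variance 1, so rejecting above `c` has limiting power `Φ(⟨g|e⟩ - c)`, which increases in
`⟨g|e⟩`. By Cauchy-Schwarz the projection is at most `a = √8 r₀` on the hypothesis and at least `b =
τ‖Λ‖ - √8 r₁` on the alternative. Both bounds are attained, at `q = (a e, b e)`, and the assumption
on the radii says `a < b`. Hence `c = u + √8 r₀` gives size at most `α` and minimum power `β`. By
Neyman-Pearson no test of level `α` does better even against the single pair `q`, and a test that
does as well must agree with the likelihood ratio test wherever the likelihood ratio stays away from
its critical value.

The limits are computed under exponential tilts of `P` in the direction `f / √n`; the truncation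
makes them exist although `f` is only square integrable. A tilt and a local alternative with the
same tangent have squared Hellinger distance `o(1/n)`, so their `n` fold products are asymptotically
indistinguishable to every test (`IsLocalAlternative.tendsto_integral_sub_tilt`). Characteristic
functions give normality under tilts (`tendsto_tilt_sum_gt`), which replaces an expansion of log
likelihoods and Le Cam's third lemma.

The tilts in direction `e` form an exponential family with statistic `truncSum`, so Neyman-Pearson
is exact for every `n` (`neymanPearson_identity`). It yields the power bound
`eventually_integral_le_of_level`, hence the maxmin property `isMaxminTest_of_ae_eq`, and uniqueness
in probability, `tendsto_measure_sub_thresholdTest`. Two independent facts complete the proof: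
scores are centered (`IsScore.integral_eq_zero`), and the pair `q` comes from the equality case of
Cauchy-Schwarz (`isLeastFavorable_hellinger_iff`). -/

/-! ### Truncated exponential tilts -/

/-- Truncation at level one. -/
def trunc (x : ℝ) : ℝ := if |x| ≤ 1 then x else 0

lemma measurable_trunc : Measurable trunc :=
  Measurable.ite (measurableSet_le (by fun_prop) measurable_const) measurable_id measurable_const

@[fun_prop]
lemma measurable_trunc_comp {f : Ω → ℝ} (hf : Measurable f) : Measurable fun x => trunc (f x) :=
  measurable_trunc.comp hf

lemma abs_trunc_le_one (x : ℝ) : |trunc x| ≤ 1 := by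
  unfold trunc; split_ifs with h
  · exact h
  · simp

lemma abs_trunc_le (x : ℝ) : |trunc x| ≤ |x| := by
  unfold trunc; split_ifs with h <;> simp

lemma trunc_of_abs_le {x : ℝ} (h : |x| ≤ 1) : trunc x = x := if_pos h

/-- The error is zero for `|x| ≤ 1` and equals `|x| < x ^ 2` beyond. At `x = f / √n`, multiplied by
`n`, it is thus dominated by `f ^ 2` for all `n`. -/
lemma abs_trunc_sub_le (x : ℝ) : |trunc x - x| ≤ x ^ 2 := by
  unfold trunc; split_ifs with h
  · simpa using sq_nonneg x
  · rw [zero_sub, abs_neg, ← sq_abs]; nlinarith [abs_nonneg x, not_le.1 h]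

lemma tendsto_inv_sqrt_natCast : Tendsto (fun n : ℕ => (√(n : ℝ))⁻¹) atTop (𝓝 0) :=
  tendsto_inv_atTop_zero.comp (Real.tendsto_sqrt_atTop.comp tendsto_natCast_atTop_atTop)

lemma eventually_trunc_div_sqrt (x : ℝ) : ∀ᶠ n : ℕ in atTop, trunc (x / √(n : ℝ)) = x / √(n : ℝ) := by
  have h : Tendsto (fun n : ℕ => |x / √(n : ℝ)|) atTop (𝓝 0) := by
    simpa [div_eq_mul_inv] using (tendsto_inv_sqrt_natCast.const_mul x).abs
  filter_upwards [h.eventually (eventually_le_nhds one_pos)] with n hn using trunc_of_abs_le hn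

/-- The exponential family through `P` in the direction of the truncated function `f / √n`. -/
def tilt (P : Measure Ω) (f : Ω → ℝ) (a : ℝ) (n : ℕ) : Measure Ω :=
  P.tilted fun x => a * trunc (f x / √(n : ℝ))

/-- The normalizing constant of `tilt`. -/
def tiltZ (P : Measure Ω) (f : Ω → ℝ) (a : ℝ) (n : ℕ) : ℝ :=
  ∫ x, Real.exp (a * trunc (f x / √(n : ℝ))) ∂P

section
variable {P : Measure Ω} [IsProbabilityMeasure P] {f g : Ω → ℝ}

lemma abs_mul_trunc_le (a y : ℝ) : |a * trunc y| ≤ |a| := by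
  rw [abs_mul]; exact mul_le_of_le_one_right (abs_nonneg a) (abs_trunc_le_one y)

lemma exp_mul_trunc_le (a y : ℝ) : Real.exp (a * trunc y) ≤ Real.exp |a| :=
  Real.exp_le_exp.2 ((le_abs_self _).trans (abs_mul_trunc_le a y))

lemma integrable_exp_mul_trunc (hf : Measurable f) (a : ℝ) (n : ℕ) :
    Integrable (fun x => Real.exp (a * trunc (f x / √(n : ℝ)))) P := by
  refine Integrable.of_bound (Measurable.aestronglyMeasurable (by fun_prop)) (Real.exp |a|)
    (ae_of_all _ fun x => ?_)
  rw [Real.norm_of_nonneg (Real.exp_pos _).le]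
  exact exp_mul_trunc_le _ _

lemma isProbabilityMeasure_tilt (hf : Measurable f) (a : ℝ) (n : ℕ) :
    IsProbabilityMeasure (tilt P f a n) :=
  isProbabilityMeasure_tilted (integrable_exp_mul_trunc hf a n)

lemma tiltZ_pos (hf : Measurable f) (a : ℝ) (n : ℕ) : 0 < tiltZ P f a n :=
  integral_exp_pos (integrable_exp_mul_trunc hf a n)

/-! ### Central limit theorem under the tilts -/

lemma norm_cexp_I_sub_le (y : ℝ) : ‖Complex.exp (Complex.I * y) - 1 - Complex.I * y‖ ≤ 2 * y ^ 2 := by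
  rcases le_or_gt |y| 1 with h | h
  · have h1 : ‖Complex.I * (y : ℂ)‖ = |y| := by simp
    have := Complex.norm_exp_sub_one_sub_id_le (x := Complex.I * y) (by rw [h1]; exact h)
    rw [h1, sq_abs] at this
    nlinarith [sq_nonneg y]
  · have h1 := norm_sub_le (Complex.exp (Complex.I * y) - 1) (Complex.I * y)
    have h2 := Real.norm_exp_I_mul_ofReal_sub_one_le (x := y)
    have h3 : ‖Complex.I * (y : ℂ)‖ = |y| := by simp
    rw [Real.norm_eq_abs] at h2
    rw [← sq_abs]; nlinarith

lemma abs_exp_sub_one_le_mul_exp {w a : ℝ} (h : |w| ≤ |a|) : |Real.exp w - 1| ≤ |w| * Real.exp |a| := by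
  have := Complex.norm_exp_sub_sum_le_norm_mul_exp w 1
  simp only [Finset.range_one, Finset.sum_singleton, pow_zero, Nat.factorial_zero, Nat.cast_one,
    div_one, pow_one, Complex.norm_real, Real.norm_eq_abs] at this
  rw [← Complex.ofReal_exp, ← Complex.ofReal_one, ← Complex.ofReal_sub, Complex.norm_real,
    Real.norm_eq_abs] at this
  exact this.trans (by gcongr)

lemma abs_exp_sub_one_sub_le_sq_mul_exp {w a : ℝ} (h : |w| ≤ |a|) :
    |Real.exp w - 1 - w| ≤ w ^ 2 * Real.exp |a| := by
  have := Complex.norm_exp_sub_sum_le_norm_mul_exp w 2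
  simp only [Finset.sum_range_succ, Finset.range_zero, Finset.sum_empty, zero_add, pow_zero,
    Nat.factorial, Nat.cast_one, div_one, pow_one, Complex.norm_real, Real.norm_eq_abs, mul_one] at this
  rw [← Complex.ofReal_exp, ← Complex.ofReal_one, ← Complex.ofReal_add, ← Complex.ofReal_sub,
    Complex.norm_real, Real.norm_eq_abs, sq_abs] at this
  rw [sub_sub]
  exact this.trans (by gcongr)

/-- Only the real part `w` needs a bound, since `exp (I y)` has modulus one. This is why the
direction of the tilt is truncated and the summand `g` is not. -/
lemma norm_cexp_add_sub_le {y w a : ℝ} (h : |w| ≤ |a|) :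
    ‖Complex.exp (Complex.I * y + w) - 1 - (Complex.I * y + w)‖ ≤ 4 * Real.exp |a| * (y ^ 2 + w ^ 2) := by
  have key : Complex.exp (Complex.I * y + w) - 1 - (Complex.I * y + w)
      = (Real.exp w : ℂ) * (Complex.exp (Complex.I * y) - 1 - Complex.I * y)
        + Complex.I * y * ((Real.exp w - 1 : ℝ) : ℂ) + ((Real.exp w - 1 - w : ℝ) : ℂ) := by
    rw [Complex.exp_add]; push_cast; ring
  rw [key]
  refine (norm_add₃_le).trans ?_
  rw [norm_mul, norm_mul, Complex.norm_real, Complex.norm_real, Complex.norm_real, norm_mul,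
    Complex.norm_I, Complex.norm_real, one_mul, Real.norm_eq_abs, Real.norm_eq_abs,
    Real.norm_eq_abs, Real.norm_eq_abs, abs_of_pos (Real.exp_pos w)]
  have h1 : Real.exp w ≤ Real.exp |a| := Real.exp_le_exp.2 ((le_abs_self _).trans h)
  have h2 := abs_exp_sub_one_le_mul_exp h
  have h3 := abs_exp_sub_one_sub_le_sq_mul_exp h
  have h4 := norm_cexp_I_sub_le y
  have h5 : Real.exp w * ‖Complex.exp (Complex.I * y) - 1 - Complex.I * y‖
      ≤ Real.exp |a| * (2 * y ^ 2) := by gcongr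
  have h6 : |y| * |Real.exp w - 1| ≤ |y| * (|w| * Real.exp |a|) := by gcongr
  have h7 : |y| * |w| ≤ y ^ 2 + w ^ 2 := by
    rw [← sq_abs y, ← sq_abs w]; nlinarith [sq_nonneg (|y| - |w|), sq_nonneg (|y|), sq_nonneg (|w|)]
  have h8 := mul_le_mul_of_nonneg_right h7 (Real.exp_pos |a|).le
  nlinarith [sq_nonneg y, sq_nonneg w, Real.exp_pos |a|,
    mul_nonneg (sq_nonneg y) (Real.exp_pos |a|).le, mul_nonneg (sq_nonneg w) (Real.exp_pos |a|).le]

lemma tendsto_natCast_mul_cexp_sub (z : ℂ) :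
    Tendsto (fun n : ℕ => (n : ℂ) * (Complex.exp (z / (√(n : ℝ) : ℝ)) - 1 - z / (√(n : ℝ) : ℝ)))
      atTop (𝓝 (z ^ 2 / 2)) := by
  rw [tendsto_iff_norm_sub_tendsto_zero]
  have hlim : Tendsto (fun n : ℕ => ‖z‖ ^ 3 * Real.exp ‖z‖ * (√(n : ℝ))⁻¹) atTop (𝓝 0) := by
    simpa using tendsto_inv_sqrt_natCast.const_mul (‖z‖ ^ 3 * Real.exp ‖z‖)
  refine squeeze_zero' (Eventually.of_forall fun _ => norm_nonneg _) ?_ hlim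
  filter_upwards [eventually_ge_atTop 1] with n hn
  have hn1 : (1 : ℝ) ≤ n := by exact_mod_cast hn
  have hs1 : 1 ≤ √(n : ℝ) := Real.one_le_sqrt.2 hn1
  have hs0 : (0 : ℝ) < √(n : ℝ) := by linarith
  have hsq : √(n : ℝ) ^ 2 = n := Real.sq_sqrt (by linarith)
  set s := √(n : ℝ) with hs
  have hsc : (s : ℂ) ≠ 0 := by exact_mod_cast hs0.ne'
  have hnc : (n : ℂ) = (s : ℂ) ^ 2 := by rw [← Complex.ofReal_pow, hsq]; simp
  have hb := Complex.norm_exp_sub_sum_le_norm_mul_exp (z / s) 3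
  have e1 : (n : ℂ) * (Complex.exp (z / s) - 1 - z / s) - z ^ 2 / 2
      = (n : ℂ) * (Complex.exp (z / s) - ∑ m ∈ Finset.range 3, (z / s) ^ m / (m.factorial : ℂ)) := by
    rw [hnc]; simp [Finset.sum_range_succ, Nat.factorial]; field_simp; ring
  rw [e1, norm_mul, Complex.norm_natCast]
  have hz : ‖z / (s : ℂ)‖ = ‖z‖ / s := by rw [norm_div, Complex.norm_real, Real.norm_of_nonneg hs0.le]
  rw [hz] at hb
  have h2 : ‖z‖ / s ≤ ‖z‖ := div_le_self (norm_nonneg _) hs1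
  calc (n : ℝ) * _ ≤ n * ((‖z‖ / s) ^ 3 * Real.exp (‖z‖ / s)) := by gcongr
    _ ≤ n * ((‖z‖ / s) ^ 3 * Real.exp ‖z‖) := by gcongr
    _ = ‖z‖ ^ 3 * Real.exp ‖z‖ * s⁻¹ := by rw [← hsq]; field_simp

lemma tendsto_natCast_mul_integral_cexp (hf : Measurable f) (hg : Measurable g)
    (hf2 : MemLp f 2 P) (hg2 : MemLp g 2 P) (hf0 : ∫ x, f x ∂P = 0) (hg0 : ∫ x, g x ∂P = 0)
    (a t : ℝ) :
    Tendsto (fun n : ℕ => (n : ℂ) *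
      (∫ x, Complex.exp (Complex.I * (t * g x / √(n : ℝ) : ℝ) + (a * trunc (f x / √(n : ℝ)) : ℝ)) ∂P - 1))
      atTop (𝓝 ((a ^ 2 / 2 * ∫ x, f x ^ 2 ∂P : ℝ) - (t ^ 2 / 2 * ∫ x, g x ^ 2 ∂P : ℝ)
        + Complex.I * (t * a * ∫ x, f x * g x ∂P : ℝ))) := by
  have if1 : Integrable f P := hf2.integrable (by norm_num)
  have ig1 : Integrable g P := hg2.integrable (by norm_num)
  have if2 : Integrable (fun x => f x ^ 2) P := hf2.integrable_sq
  have ig2 : Integrable (fun x => g x ^ 2) P := hg2.integrable_sq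
  have ifg : Integrable (fun x => f x * g x) P := hf2.integrable_mul hg2
  -- The subtracted linear term is left untruncated: its integral then vanishes by centering, and
  -- the truncation error goes into the dominating function.
  set F : ℕ → Ω → ℂ := fun n x => (n : ℂ) *
    (Complex.exp (Complex.I * (t * g x / √(n : ℝ) : ℝ) + (a * trunc (f x / √(n : ℝ)) : ℝ)) - 1
      - ((Complex.I * t * g x + a * f x) / (√(n : ℝ) : ℝ))) with hF
  have hmain : Tendsto (fun n => ∫ x, F n x ∂P) atTop
      (𝓝 (∫ x, (Complex.I * t * g x + a * f x) ^ 2 / 2 ∂P)) := by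
    refine tendsto_integral_of_dominated_convergence
      (fun x => 4 * Real.exp |a| * ((t * g x) ^ 2 + (a * f x) ^ 2) + |a| * f x ^ 2) ?_ ?_ ?_ ?_
    · intro n
      refine Measurable.aestronglyMeasurable ?_
      simp only [hF]
      fun_prop
    · simp only [mul_pow]
      exact (((ig2.const_mul _).add (if2.const_mul _)).const_mul _).add (if2.const_mul _)
    · intro n
      refine ae_of_all _ fun x => ?_
      rcases Nat.eq_zero_or_pos n with rfl | hn
      · simp only [hF, Nat.cast_zero, zero_mul, norm_zero]; positivity
      have hn0 : (0 : ℝ) < n := by exact_mod_cast hn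
      have hs0 : 0 < √(n : ℝ) := Real.sqrt_pos.2 hn0
      have hsq : √(n : ℝ) ^ 2 = n := Real.sq_sqrt hn0.le
      have e1 : F n x = (n : ℂ) * (Complex.exp (Complex.I * (t * g x / √(n : ℝ) : ℝ)
            + (a * trunc (f x / √(n : ℝ)) : ℝ)) - 1
            - (Complex.I * (t * g x / √(n : ℝ) : ℝ) + (a * trunc (f x / √(n : ℝ)) : ℝ)))
          + ((n * (a * (trunc (f x / √(n : ℝ)) - f x / √(n : ℝ))) : ℝ) : ℂ) := by
        simp only [hF]; push_cast; ring
      rw [e1]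
      refine (norm_add_le _ _).trans (add_le_add ?_ ?_)
      · rw [norm_mul, Complex.norm_natCast]
        have hw : (a * trunc (f x / √(n : ℝ))) ^ 2 ≤ (a * f x / √(n : ℝ)) ^ 2 := by
          rw [sq_le_sq, mul_div_assoc, abs_mul, abs_mul]
          exact mul_le_mul_of_nonneg_left (abs_trunc_le _) (abs_nonneg _)
        calc (n : ℝ) * _ ≤ n * (4 * Real.exp |a| * ((t * g x / √(n : ℝ)) ^ 2
              + (a * trunc (f x / √(n : ℝ))) ^ 2)) :=
              mul_le_mul_of_nonneg_left (norm_cexp_add_sub_le (abs_mul_trunc_le _ _)) hn0.le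
          _ ≤ n * (4 * Real.exp |a| * ((t * g x / √(n : ℝ)) ^ 2 + (a * f x / √(n : ℝ)) ^ 2)) := by
              gcongr
          _ = _ := by rw [div_pow, div_pow, hsq]; field_simp
      · rw [Complex.norm_real, Real.norm_eq_abs, abs_mul, abs_mul, abs_of_pos hn0]
        calc (n : ℝ) * (|a| * |trunc (f x / √(n : ℝ)) - f x / √(n : ℝ)|)
            ≤ n * (|a| * (f x / √(n : ℝ)) ^ 2) := by gcongr; exact abs_trunc_sub_le _
          _ = _ := by rw [div_pow, hsq]; field_simp
    · refine ae_of_all _ fun x => ?_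
      refine (tendsto_natCast_mul_cexp_sub (Complex.I * t * g x + a * f x)).congr' ?_
      filter_upwards [eventually_trunc_div_sqrt (f x)] with n hn
      simp only [hF, hn]
      push_cast
      congr 4
      ring
  have hlim : ∫ x, (Complex.I * t * g x + a * f x) ^ 2 / 2 ∂P
      = (a ^ 2 / 2 * ∫ x, f x ^ 2 ∂P : ℝ) - (t ^ 2 / 2 * ∫ x, g x ^ 2 ∂P : ℝ)
        + Complex.I * (t * a * ∫ x, f x * g x ∂P : ℝ) := by
    have e : ∀ x, (Complex.I * t * g x + a * f x) ^ 2 / 2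
        = ((a ^ 2 / 2 * f x ^ 2 - t ^ 2 / 2 * g x ^ 2 : ℝ) : ℂ)
          + Complex.I * ((t * a * (f x * g x) : ℝ) : ℂ) := by
      intro x; push_cast; ring_nf; rw [Complex.I_sq]; ring
    simp_rw [e]
    rw [integral_add, integral_const_mul, integral_complex_ofReal, integral_complex_ofReal,
      integral_sub (if2.const_mul _) (ig2.const_mul _), integral_const_mul, integral_const_mul,
      integral_const_mul]
    · push_cast; ring
    · exact ((if2.const_mul _).sub (ig2.const_mul _)).ofReal
    · exact ((ifg.const_mul _).ofReal (𝕜 := ℂ)).const_mul _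
  rw [hlim] at hmain
  refine hmain.congr fun n => ?_
  simp only [hF]
  rw [integral_const_mul]
  congr 1
  have iexp : Integrable (fun x => Complex.exp (Complex.I * (t * g x / √(n : ℝ) : ℝ)
      + (a * trunc (f x / √(n : ℝ)) : ℝ))) P := by
    refine Integrable.of_bound (Measurable.aestronglyMeasurable (by fun_prop)) (Real.exp |a|)
      (ae_of_all _ fun x => ?_)
    rw [Complex.norm_exp]
    simpa using exp_mul_trunc_le a (f x / √(n : ℝ))
  have ig' : Integrable (fun x => Complex.I * t * (g x : ℂ)) P := (ig1.ofReal (𝕜 := ℂ)).const_mul _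
  have if' : Integrable (fun x => (a : ℂ) * (f x : ℂ)) P := (if1.ofReal (𝕜 := ℂ)).const_mul _
  have iu : Integrable (fun x => Complex.I * t * g x + a * f x) P := ig'.add if'
  have iexp1 : Integrable (fun x => Complex.exp (Complex.I * (t * g x / √(n : ℝ) : ℝ)
      + (a * trunc (f x / √(n : ℝ)) : ℝ)) - 1) P := iexp.sub (integrable_const _)
  rw [integral_sub iexp1 (iu.div_const _), integral_sub iexp (integrable_const _), integral_div,
    integral_add ig' if',
    integral_const_mul, integral_const_mul, integral_complex_ofReal, integral_complex_ofReal, hf0, hg0]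
  simp

lemma tendsto_integral_cexp_pow (hf : Measurable f) (hg : Measurable g)
    (hf2 : MemLp f 2 P) (hg2 : MemLp g 2 P) (hf0 : ∫ x, f x ∂P = 0) (hg0 : ∫ x, g x ∂P = 0)
    (a t : ℝ) :
    Tendsto (fun n : ℕ =>
      (∫ x, Complex.exp (Complex.I * (t * g x / √(n : ℝ) : ℝ) + (a * trunc (f x / √(n : ℝ)) : ℝ)) ∂P) ^ n)
      atTop (𝓝 (Complex.exp ((a ^ 2 / 2 * ∫ x, f x ^ 2 ∂P : ℝ) - (t ^ 2 / 2 * ∫ x, g x ^ 2 ∂P : ℝ)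
        + Complex.I * (t * a * ∫ x, f x * g x ∂P : ℝ)))) := by
  refine (Complex.tendsto_one_add_pow_exp_of_tendsto
    (tendsto_natCast_mul_integral_cexp hf hg hf2 hg2 hf0 hg0 a t)).congr fun n => ?_
  rw [add_sub_cancel]

lemma tendsto_tiltZ_pow (hf : Measurable f) (hf2 : MemLp f 2 P) (hf0 : ∫ x, f x ∂P = 0) (a : ℝ) :
    Tendsto (fun n : ℕ => tiltZ P f a n ^ n) atTop (𝓝 (Real.exp (a ^ 2 / 2 * ∫ x, f x ^ 2 ∂P))) := by
  have h := (Complex.continuous_re.tendsto _).comp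
    (tendsto_integral_cexp_pow hf hf hf2 hf2 hf0 hf0 a 0)
  have e : ∀ n : ℕ, ∫ x, Complex.exp (Complex.I * ((0 : ℝ) * f x / √(n : ℝ) : ℝ)
      + (a * trunc (f x / √(n : ℝ)) : ℝ)) ∂P = (tiltZ P f a n : ℂ) := by
    intro n
    rw [tiltZ, ← integral_complex_ofReal]
    simp
  have h' : Complex.exp ((a ^ 2 / 2 * ∫ x, f x ^ 2 ∂P : ℝ) - ((0 : ℝ) ^ 2 / 2 * ∫ x, f x ^ 2 ∂P : ℝ)
        + Complex.I * ((0 : ℝ) * a * ∫ x, f x * f x ∂P : ℝ))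
      = (Real.exp (a ^ 2 / 2 * ∫ x, f x ^ 2 ∂P) : ℂ) := by
    rw [Complex.ofReal_exp]; simp
  rw [h'] at h
  refine (h.congr fun n => ?_).trans_eq ?_
  · simp only [Function.comp, e, ← Complex.ofReal_pow, Complex.ofReal_re]
  · rw [Complex.ofReal_re]


/-- Independence turns the characteristic function into an `n`-th power, and the density of the tilt
supplies the factor `exp (a * trunc _) / tiltZ` in each coordinate. -/
lemma charFun_map_sum_tilt (hf : Measurable f) (hg : Measurable g) (a t : ℝ) (n : ℕ) :
    charFun ((Measure.pi fun _ : Fin n => tilt P f a n).map fun x => (√(n : ℝ))⁻¹ * ∑ i, g (x i)) t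
      = (∫ x, Complex.exp (Complex.I * (t * g x / √(n : ℝ) : ℝ)
          + (a * trunc (f x / √(n : ℝ)) : ℝ)) ∂P) ^ n / (tiltZ P f a n : ℂ) ^ n := by
  have := isProbabilityMeasure_tilt (P := P) hf a n
  rw [charFun_apply_real, integral_map (Measurable.aemeasurable (by fun_prop))
    (Measurable.aestronglyMeasurable (by fun_prop)), ← div_pow]
  have e1 : ∀ x : Fin n → Ω, Complex.exp (t * ((√(n : ℝ))⁻¹ * ∑ i, g (x i) : ℝ) * Complex.I)
      = ∏ i, Complex.exp (Complex.I * (t * g (x i) / √(n : ℝ) : ℝ)) := by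
    intro x
    rw [← Complex.exp_sum]
    congr 1
    push_cast
    rw [Finset.mul_sum, Finset.mul_sum, Finset.sum_mul]
    exact Finset.sum_congr rfl fun i _ => by ring
  simp_rw [e1]
  rw [integral_fintype_prod_eq_pow (ι := Fin n)
    (fun x => Complex.exp (Complex.I * (t * g x / √(n : ℝ) : ℝ))), Fintype.card_fin]
  congr 1
  rw [tilt, integral_tilted, ← integral_div]
  refine integral_congr_ae (ae_of_all _ fun x => ?_)
  simp only [Complex.real_smul, tiltZ]
  rw [Complex.exp_add, Complex.ofReal_div, Complex.ofReal_exp]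
  ring

lemma gaussianReal_real_Ioi (m c : ℝ) :
    (gaussianReal m 1).real (Set.Ioi c) = cdf (gaussianReal 0 1) (m - c) := by
  have h := gaussianReal_map_const_sub (μ := 0) (v := 1) m
  rw [sub_zero] at h
  have : NullSingletonClass (gaussianReal 0 1) := nullSingletonClass_gaussianReal one_ne_zero
  rw [← h, map_measureReal_apply (by fun_prop) measurableSet_Ioi, cdf_eq_real]
  have e : (fun x => m - x) ⁻¹' Set.Ioi c = Set.Iio (m - c) := by
    ext x; simp only [Set.mem_preimage, Set.mem_Ioi, Set.mem_Iio]; constructor <;> intro h <;> linarith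
  rw [e]
  exact measureReal_congr Iio_ae_eq_Iic

/-- Asymptotic normality of standardized sums under the tilts. -/
theorem tendsto_tilt_sum_gt (hf : Measurable f) (hg : Measurable g)
    (hf2 : MemLp f 2 P) (hg2 : MemLp g 2 P) (hf0 : ∫ x, f x ∂P = 0) (hg0 : ∫ x, g x ∂P = 0)
    (hg1 : ∫ x, g x ^ 2 ∂P = 1) (a c : ℝ) :
    Tendsto (fun n : ℕ => (Measure.pi fun _ : Fin n => tilt P f a n).real
        {x | c < (√(n : ℝ))⁻¹ * ∑ i, g (x i)}) atTop
      (𝓝 (cdf (gaussianReal 0 1) (a * ∫ x, f x * g x ∂P - c))) := by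
  have hprob := fun n => isProbabilityMeasure_tilt (P := P) hf a n
  have hm : ∀ n : ℕ, Measurable fun x : Fin n → Ω => (√(n : ℝ))⁻¹ * ∑ i, g (x i) := fun n => by fun_prop
  set m := a * ∫ x, f x * g x ∂P with hmdef
  let ν : ℕ → ProbabilityMeasure ℝ := fun n =>
    ⟨(Measure.pi fun _ : Fin n => tilt P f a n).map fun x => (√(n : ℝ))⁻¹ * ∑ i, g (x i),
      Measure.isProbabilityMeasure_map (hm n).aemeasurable⟩
  let ν₀ : ProbabilityMeasure ℝ := ⟨gaussianReal m 1, inferInstance⟩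
  have hν : Tendsto ν atTop (𝓝 ν₀) := by
    refine ProbabilityMeasure.tendsto_iff_tendsto_charFun.2 fun t => ?_
    simp only [ν, ν₀, ProbabilityMeasure.coe_mk, charFun_map_sum_tilt hf hg]
    have h1 := tendsto_integral_cexp_pow hf hg hf2 hg2 hf0 hg0 a t
    have h2 := (Complex.continuous_ofReal.tendsto _).comp (tendsto_tiltZ_pow hf hf2 hf0 a)
    -- Dividing by the normalizing constants cancels the term in `a ^ 2`. What remains is a normal
    -- characteristic function whose mean is shifted by `a ⟨f|g⟩`.
    have h3 := h1.div h2 (by simp)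
    refine (h3.congr fun n => by simp).trans_eq ?_
    rw [charFun_gaussianReal, hg1, Complex.ofReal_exp, ← Complex.exp_sub, hmdef]
    congr 2
    push_cast
    ring
  have : NullSingletonClass (gaussianReal m 1) := nullSingletonClass_gaussianReal one_ne_zero
  have h := ProbabilityMeasure.tendsto_measure_of_null_frontier_of_tendsto' hν (E := Set.Ioi c)
    (by simp [ν₀])
  have h' := (ENNReal.tendsto_toReal (measure_ne_top _ _)).comp h
  refine (h'.congr fun n => ?_).trans_eq ?_
  · simp only [Function.comp, ν, ProbabilityMeasure.coe_mk]
    rw [Measure.map_apply (hm n) measurableSet_Ioi]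
    rfl
  · rw [← gaussianReal_real_Ioi m c]; rfl

end

/-! ### Hellinger bounds for product measures -/

lemma pi_withDensity_ofReal {μ : Measure Ω} [SigmaFinite μ] {f : Ω → ℝ} (hf0 : ∀ x, 0 ≤ f x)
    (hf : Integrable f μ) (n : ℕ) :
    (Measure.pi fun _ : Fin n => μ.withDensity fun x => ENNReal.ofReal (f x))
      = (Measure.pi fun _ : Fin n => μ).withDensity fun x => ENNReal.ofReal (∏ i, f (x i)) := by
  have : IsFiniteMeasure (μ.withDensity fun x => ENNReal.ofReal (f x)) :=
    isFiniteMeasure_withDensity_ofReal hf.2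
  refine (Measure.pi_eq fun s hs => ?_)
  rw [withDensity_apply _ (MeasurableSet.univ_pi hs), Measure.restrict_pi_pi,
    ← ofReal_integral_eq_lintegral_ofReal
      (Integrable.fintype_prod (f := fun _ => f) fun i => hf.mono_measure Measure.restrict_le_self)
      (ae_of_all _ fun x => Finset.prod_nonneg fun i _ => hf0 _),
    integral_fintype_prod_eq_prod (fun _ => f),
    ENNReal.ofReal_prod_of_nonneg fun i _ => integral_nonneg fun x => hf0 x]
  refine Finset.prod_congr rfl fun i _ => ?_
  rw [withDensity_apply _ (hs i), ofReal_integral_eq_lintegral_ofReal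
    (hf.mono_measure Measure.restrict_le_self) (ae_of_all _ hf0)]

lemma integral_withDensity_ofReal {X : Type*} [MeasurableSpace X] {m : Measure X} {F : X → ℝ}
    (hF : AEMeasurable F m) (hF0 : ∀ x, 0 ≤ F x) (δ : X → ℝ) :
    ∫ x, δ x ∂(m.withDensity fun x => ENNReal.ofReal (F x)) = ∫ x, F x * δ x ∂m := by
  rw [integral_withDensity_eq_integral_toReal_smul₀ hF.ennreal_ofReal (ae_of_all _ fun _ => by simp)]
  simp [ENNReal.toReal_ofReal (hF0 _)]

lemma integrable_sqrt_mul {X : Type*} [MeasurableSpace X] {m : Measure X} {F G : X → ℝ}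
    (hF0 : ∀ x, 0 ≤ F x) (hG0 : ∀ x, 0 ≤ G x) (hF : Integrable F m) (hG : Integrable G m) :
    Integrable (fun x => √(F x * G x)) m := by
  refine (hF.add hG).mono' ((hF.1.mul hG.1).aemeasurable.sqrt.aestronglyMeasurable)
    (ae_of_all _ fun x => ?_)
  rw [Real.norm_of_nonneg (Real.sqrt_nonneg _), Pi.add_apply, Real.sqrt_le_left (add_nonneg (hF0 x) (hG0 x))]
  nlinarith [hF0 x, hG0 x, mul_nonneg (hF0 x) (hG0 x)]

lemma sqrt_sub_sqrt_sq {a b : ℝ} (ha : 0 ≤ a) (hb : 0 ≤ b) :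
    (√a - √b) ^ 2 = a + b - 2 * √(a * b) := by
  rw [Real.sqrt_mul ha, sub_sq, Real.sq_sqrt ha, Real.sq_sqrt hb]; ring

lemma integral_sqrt_sub_sqrt_sq {X : Type*} [MeasurableSpace X] {m : Measure X} {F G : X → ℝ}
    (hF0 : ∀ x, 0 ≤ F x) (hG0 : ∀ x, 0 ≤ G x) (hF : Integrable F m) (hG : Integrable G m) :
    ∫ x, (√(F x) - √(G x)) ^ 2 ∂m = ∫ x, F x ∂m + ∫ x, G x ∂m - 2 * ∫ x, √(F x * G x) ∂m := by
  simp_rw [fun x => sqrt_sub_sqrt_sq (hF0 x) (hG0 x)]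
  have h1 : Integrable (fun x => F x + G x) m := hF.add hG
  rw [integral_sub h1 ((integrable_sqrt_mul hF0 hG0 hF hG).const_mul 2), integral_add hF hG,
    integral_const_mul]

/-- The Hellinger bound for the difference of the powers of a test. -/
lemma abs_integral_mul_sub_le {X : Type*} [MeasurableSpace X] {m : Measure X} {F G δ : X → ℝ}
    (hF0 : ∀ x, 0 ≤ F x) (hG0 : ∀ x, 0 ≤ G x) (hF : Integrable F m) (hG : Integrable G m)
    (hδ : AEStronglyMeasurable δ m) (hδ1 : ∀ x, |δ x| ≤ 1) {κ : ℝ} (hκ : 0 < κ) :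
    |∫ x, F x * δ x ∂m - ∫ x, G x * δ x ∂m|
      ≤ κ⁻¹ * ∫ x, (√(F x) - √(G x)) ^ 2 ∂m + 2 * κ * (∫ x, F x ∂m + ∫ x, G x ∂m) := by
  have iF : Integrable (fun x => F x * δ x) m := hF.mul_bdd hδ (ae_of_all _ hδ1)
  have iG : Integrable (fun x => G x * δ x) m := hG.mul_bdd hδ (ae_of_all _ hδ1)
  have iH : Integrable (fun x => (√(F x) - √(G x)) ^ 2) m := by
    simp_rw [fun x => sqrt_sub_sqrt_sq (hF0 x) (hG0 x)]
    exact (hF.add hG).sub ((integrable_sqrt_mul hF0 hG0 hF hG).const_mul 2)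
  have iFG : Integrable (fun x => F x + G x) m := hF.add hG
  rw [← integral_sub iF iG, ← integral_add hF hG, ← integral_const_mul, ← integral_const_mul,
    ← integral_add (iH.const_mul _) (iFG.const_mul _)]
  refine (norm_integral_le_integral_norm (fun x => F x * δ x - G x * δ x)).trans
    (integral_mono (iF.sub iG).norm ((iH.const_mul _).add (iFG.const_mul _)) fun x => ?_)
  simp only [Real.norm_eq_abs, ← sub_mul, abs_mul]
  refine (mul_le_of_le_one_right (abs_nonneg _) (hδ1 x)).trans ?_
  have e : F x - G x = (√(F x) - √(G x)) * (√(F x) + √(G x)) := by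
    ring_nf; rw [Real.sq_sqrt (hF0 x), Real.sq_sqrt (hG0 x)]
  rw [e, abs_mul, ← sq_abs (√(F x) - √(G x))]
  set d := |√(F x) - √(G x)|
  set b := |√(F x) + √(G x)| with hb
  have hb2 : b ^ 2 ≤ 2 * (F x + G x) := by
    rw [hb, sq_abs]
    nlinarith [sq_nonneg (√(F x) - √(G x)), Real.sq_sqrt (hF0 x), Real.sq_sqrt (hG0 x)]
  -- A weighted inequality of means with free `κ` stands in for Cauchy-Schwarz, so that no square
  -- root of an integral appears.
  have h1 : d * b ≤ κ⁻¹ * d ^ 2 + κ * b ^ 2 := by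
    have h2 : κ⁻¹ * d ^ 2 + κ * b ^ 2 - d * b
        = κ⁻¹ * ((d - κ * b / 2) ^ 2 + 3 / 4 * (κ * b) ^ 2) := by field_simp; ring
    have h3 : 0 ≤ κ⁻¹ * ((d - κ * b / 2) ^ 2 + 3 / 4 * (κ * b) ^ 2) := by positivity
    linarith
  nlinarith

/-- Bernoulli's inequality. With `A` the Hellinger affinity, it bounds the squared distance of `n`
fold products by `n` times that of the factors. -/
lemma pow_two_sub_le {A : ℝ} (h0 : 0 ≤ A) (n : ℕ) : 1 + 1 - 2 * A ^ n ≤ n * (1 + 1 - 2 * A) := by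
  have := one_add_mul_le_pow (a := A - 1) (by linarith) n
  rw [add_sub_cancel] at this
  linarith

/-- The Hellinger bound for product measures. -/
theorem abs_integral_pi_sub_le {μ : Measure Ω} [SigmaFinite μ] {f g : Ω → ℝ}
    (hf0 : ∀ x, 0 ≤ f x) (hg0 : ∀ x, 0 ≤ g x) (hf : Integrable f μ) (hg : Integrable g μ)
    (hf1 : ∫ x, f x ∂μ = 1) (hg1 : ∫ x, g x ∂μ = 1) {n : ℕ} {δ : (Fin n → Ω) → ℝ}
    (hδ : Measurable δ) (hδ1 : ∀ x, |δ x| ≤ 1) {κ : ℝ} (hκ : 0 < κ) :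
    |∫ x, δ x ∂(Measure.pi fun _ : Fin n => μ.withDensity fun x => ENNReal.ofReal (f x))
        - ∫ x, δ x ∂(Measure.pi fun _ : Fin n => μ.withDensity fun x => ENNReal.ofReal (g x))|
      ≤ κ⁻¹ * (n * ∫ x, (√(f x) - √(g x)) ^ 2 ∂μ) + 4 * κ := by
  have hF0 : ∀ x : Fin n → Ω, 0 ≤ ∏ i, f (x i) := fun x => Finset.prod_nonneg fun i _ => hf0 _
  have hG0 : ∀ x : Fin n → Ω, 0 ≤ ∏ i, g (x i) := fun x => Finset.prod_nonneg fun i _ => hg0 _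
  have iF : Integrable (fun x : Fin n → Ω => ∏ i, f (x i)) (Measure.pi fun _ : Fin n => μ) :=
    Integrable.fintype_prod (f := fun _ => f) fun _ => hf
  have iG : Integrable (fun x : Fin n → Ω => ∏ i, g (x i)) (Measure.pi fun _ : Fin n => μ) :=
    Integrable.fintype_prod (f := fun _ => g) fun _ => hg
  rw [pi_withDensity_ofReal hf0 hf, pi_withDensity_ofReal hg0 hg,
    integral_withDensity_ofReal iF.1.aemeasurable hF0,
    integral_withDensity_ofReal iG.1.aemeasurable hG0]
  refine (abs_integral_mul_sub_le hF0 hG0 iF iG hδ.aestronglyMeasurable hδ1 hκ).trans ?_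
  have eF : ∫ x : Fin n → Ω, ∏ i, f (x i) ∂(Measure.pi fun _ : Fin n => μ) = 1 := by
    rw [integral_fintype_prod_eq_pow (ι := Fin n) f, hf1, one_pow]
  have eG : ∫ x : Fin n → Ω, ∏ i, g (x i) ∂(Measure.pi fun _ : Fin n => μ) = 1 := by
    rw [integral_fintype_prod_eq_pow (ι := Fin n) g, hg1, one_pow]
  have eFG : ∫ x : Fin n → Ω, √((∏ i, f (x i)) * ∏ i, g (x i)) ∂(Measure.pi fun _ : Fin n => μ)
      = (∫ x, √(f x * g x) ∂μ) ^ n := by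
    simp_rw [← Finset.prod_mul_distrib,
      fun x : Fin n → Ω => Real.sqrt_prod Finset.univ (x := fun i => f (x i) * g (x i))
        fun i _ => mul_nonneg (hf0 _) (hg0 _)]
    rw [integral_fintype_prod_eq_pow (ι := Fin n) (fun x => √(f x * g x)), Fintype.card_fin]
  rw [integral_sqrt_sub_sqrt_sq hF0 hG0 iF iG, integral_sqrt_sub_sqrt_sq hf0 hg0 hf hg, eF, eG, eFG,
    hf1, hg1]
  have := mul_le_mul_of_nonneg_left
    (pow_two_sub_le (A := ∫ x, √(f x * g x) ∂μ) (integral_nonneg fun _ => Real.sqrt_nonneg _) n)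
    (inv_nonneg.2 hκ.le)
  linarith

/-! ### Hellinger approximation of local alternatives by tilts -/

lemma two_mul_ofReal (x : ℝ) : 2 * ENNReal.ofReal x = ENNReal.ofReal (2 * x) := by
  rw [ENNReal.ofReal_mul zero_le_two, ENNReal.ofReal_ofNat]

section
variable {P : Measure Ω} [IsProbabilityMeasure P] {f : Ω → ℝ}

lemma tendsto_natCast_mul_tiltZ_sub_one (hf : Measurable f) (hf2 : MemLp f 2 P)
    (hf0 : ∫ x, f x ∂P = 0) (a : ℝ) :
    Tendsto (fun n : ℕ => n * (tiltZ P f a n - 1)) atTop (𝓝 (a ^ 2 / 2 * ∫ x, f x ^ 2 ∂P)) := by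
  have h := (Complex.continuous_re.tendsto _).comp
    (tendsto_natCast_mul_integral_cexp hf hf hf2 hf2 hf0 hf0 a 0)
  have hr : ∀ y w : ℝ, ((y : ℂ) - ((0 : ℝ) ^ 2 / 2 * w : ℝ)
      + Complex.I * ((0 : ℝ) * a * ∫ x, f x * f x ∂P : ℝ)).re = y := fun y w => by simp
  rw [hr] at h
  refine h.congr fun n => ?_
  have e : ∫ x, Complex.exp (Complex.I * ((0 : ℝ) * f x / √(n : ℝ) : ℝ)
      + (a * trunc (f x / √(n : ℝ)) : ℝ)) ∂P = (tiltZ P f a n : ℂ) := by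
    rw [tiltZ, ← integral_complex_ofReal]
    simp
  simp only [Function.comp, e]
  rw [← Complex.ofReal_one, ← Complex.ofReal_sub, ← Complex.ofReal_natCast, ← Complex.ofReal_mul,
    Complex.ofReal_re]

lemma tendsto_tiltZ (hf : Measurable f) (hf2 : MemLp f 2 P) (hf0 : ∫ x, f x ∂P = 0) (a : ℝ) :
    Tendsto (fun n : ℕ => tiltZ P f a n) atTop (𝓝 1) := by
  have h := ((tendsto_natCast_mul_tiltZ_sub_one hf hf2 hf0 a).mul
    (tendsto_inv_atTop_nhds_zero_nat (𝕜 := ℝ))).add_const 1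
  rw [mul_zero, zero_add] at h
  refine h.congr' ?_
  filter_upwards [eventually_ge_atTop 1] with n hn
  have : (n : ℝ) ≠ 0 := by positivity
  field_simp
  ring

/-- The normalizing constant is `1 + O(1/n)`, so it is invisible at the scale `1/√n`. The bound used
is `(1 - Z^(-1/2)) ^ 2 ≤ (Z - 1) ^ 2 / Z`. -/
lemma tendsto_natCast_mul_inv_sqrt_tiltZ_sub_one_sq (hf : Measurable f) (hf2 : MemLp f 2 P)
    (hf0 : ∫ x, f x ∂P = 0) (a : ℝ) :
    Tendsto (fun n : ℕ => n * (1 - (√(tiltZ P f a n))⁻¹) ^ 2) atTop (𝓝 0) := by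
  have hZ := tendsto_tiltZ hf hf2 hf0 a
  have h := ((tendsto_natCast_mul_tiltZ_sub_one hf hf2 hf0 a).mul (hZ.sub_const 1)).mul
    (hZ.inv₀ one_ne_zero)
  simp only [sub_self, mul_zero, zero_mul] at h
  refine squeeze_zero (fun n => by positivity) (fun n => ?_) h
  have hp := tiltZ_pos (P := P) hf a n
  set z := √(tiltZ P f a n) with hz
  have hz0 : 0 < z := Real.sqrt_pos.2 hp
  have hzz : tiltZ P f a n = z ^ 2 := (Real.sq_sqrt hp.le).symm
  rw [hzz]
  have e1 : (n : ℝ) * (1 - z⁻¹) ^ 2 = n * (z - 1) ^ 2 * (z ^ 2)⁻¹ := by field_simp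
  have e2 : (n : ℝ) * (z ^ 2 - 1) * (z ^ 2 - 1) * (z ^ 2)⁻¹
      = n * (z - 1) ^ 2 * (z ^ 2)⁻¹ * (z + 1) ^ 2 := by ring
  rw [e1, e2]
  refine le_mul_of_one_le_right (by positivity) ?_
  nlinarith

/-- By the second order expansion the difference is `O(1/n)` at fixed `x`; together with the
domination in `sq_exp_half_sub_le` this gives convergence in mean square. -/
lemma tendsto_natCast_mul_exp_half_sub_sq (x a : ℝ) :
    Tendsto (fun n : ℕ => n * (1 + 1 / 2 * (1 / √(n : ℝ)) * (a * x)
      - Real.exp (a * trunc (x / √(n : ℝ)) / 2)) ^ 2) atTop (𝓝 0) := by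
  have h := (Complex.continuous_re.tendsto _).comp (tendsto_natCast_mul_cexp_sub ((a * x / 2 : ℝ) : ℂ))
  have h2 := (h.pow 2).mul (tendsto_inv_atTop_nhds_zero_nat (𝕜 := ℝ))
  rw [mul_zero] at h2
  refine h2.congr' ?_
  filter_upwards [eventually_trunc_div_sqrt x, eventually_ge_atTop 1] with n hn h1
  have hn0 : (n : ℝ) ≠ 0 := by positivity
  simp only [Function.comp]
  rw [hn, ← Complex.ofReal_div, ← Complex.ofReal_exp, ← Complex.ofReal_one, ← Complex.ofReal_sub,
    ← Complex.ofReal_sub, ← Complex.ofReal_natCast, ← Complex.ofReal_mul, Complex.ofReal_re]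
  have e : a * (x / √(n : ℝ)) / 2 = a * x / 2 / √(n : ℝ) := by ring
  rw [e]
  field_simp
  ring

lemma sq_exp_half_sub_le (x a : ℝ) (n : ℕ) :
    n * (1 + 1 / 2 * (1 / √(n : ℝ)) * (a * x) - Real.exp (a * trunc (x / √(n : ℝ)) / 2)) ^ 2
      ≤ (Real.exp |a / 2| + 1) ^ 2 * (a / 2) ^ 2 * x ^ 2 := by
  rcases Nat.eq_zero_or_pos n with rfl | hn
  · simp only [Nat.cast_zero, zero_mul]; positivity
  have hn0 : (0 : ℝ) < n := by exact_mod_cast hn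
  have hsq : √(n : ℝ) ^ 2 = n := Real.sq_sqrt hn0.le
  set w := a * trunc (x / √(n : ℝ)) / 2 with hw
  set v := a / 2 * (x / √(n : ℝ)) with hv
  have hw' : w = a / 2 * trunc (x / √(n : ℝ)) := by rw [hw]; ring
  have hwa : |w| ≤ |a / 2| := by rw [hw']; exact abs_mul_trunc_le _ _
  have hwv : |w| ≤ |v| := by
    rw [hw', hv, abs_mul, abs_mul]; exact mul_le_mul_of_nonneg_left (abs_trunc_le _) (abs_nonneg _)
  have h1 := abs_exp_sub_one_le_mul_exp hwa
  have e : 1 + 1 / 2 * (1 / √(n : ℝ)) * (a * x) - Real.exp w = v - (Real.exp w - 1) := by rw [hv]; ring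
  have h2 : |v - (Real.exp w - 1)| ≤ (Real.exp |a / 2| + 1) * |v| := by
    refine (abs_sub _ _).trans ?_
    have := mul_le_mul_of_nonneg_right hwv (Real.exp_pos |a / 2|).le
    linarith
  rw [e, ← sq_abs (v - _)]
  calc (n : ℝ) * |v - (Real.exp w - 1)| ^ 2 ≤ n * ((Real.exp |a / 2| + 1) * |v|) ^ 2 := by gcongr
    _ = _ := by rw [mul_pow, sq_abs, hv, mul_pow, div_pow x, hsq]; field_simp

/-- The square roots of the densities of the tilts are differentiable with tangent `a f`. -/
lemma tendsto_natCast_mul_integral_tilt_defect (hf : Measurable f) (hf2 : MemLp f 2 P)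
    (hf0 : ∫ x, f x ∂P = 0) (a : ℝ) :
    Tendsto (fun n : ℕ => ∫⁻ x, ENNReal.ofReal (n * (1 + 1 / 2 * (1 / √(n : ℝ)) * (a * f x)
      - √(Real.exp (a * trunc (f x / √(n : ℝ))) / tiltZ P f a n)) ^ 2) ∂P) atTop (𝓝 0) := by
  have if2 : Integrable (fun x => f x ^ 2) P := hf2.integrable_sq
  have hm : ∀ n : ℕ, Measurable fun x => (n : ℝ) * (1 + 1 / 2 * (1 / √(n : ℝ)) * (a * f x)
      - Real.exp (a * trunc (f x / √(n : ℝ)) / 2)) ^ 2 := fun n => by fun_prop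
  have h1 : Tendsto (fun n : ℕ => ∫⁻ x, ENNReal.ofReal (n * (1 + 1 / 2 * (1 / √(n : ℝ)) * (a * f x)
      - Real.exp (a * trunc (f x / √(n : ℝ)) / 2)) ^ 2) ∂P) atTop (𝓝 (∫⁻ _, 0 ∂P)) := by
    refine tendsto_lintegral_of_dominated_convergence
      (fun x => ENNReal.ofReal ((Real.exp |a / 2| + 1) ^ 2 * (a / 2) ^ 2 * f x ^ 2))
      (fun n => (hm n).ennreal_ofReal) (fun n => ae_of_all _ fun x =>
        ENNReal.ofReal_le_ofReal (sq_exp_half_sub_le _ _ _)) ?_ (ae_of_all _ fun x => ?_)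
    · exact (if2.const_mul _).lintegral_lt_top.ne
    · simpa using ENNReal.tendsto_ofReal (tendsto_natCast_mul_exp_half_sub_sq (f x) a)
  have h2 : Tendsto (fun n : ℕ => ENNReal.ofReal
      (Real.exp |a| * (n * (1 - (√(tiltZ P f a n))⁻¹) ^ 2))) atTop (𝓝 0) := by
    simpa using ENNReal.tendsto_ofReal
      ((tendsto_natCast_mul_inv_sqrt_tiltZ_sub_one_sq hf hf2 hf0 a).const_mul (Real.exp |a|))
  rw [lintegral_zero] at h1
  have h3 := ENNReal.Tendsto.const_mul (a := 2) (h1.add h2) (Or.inr (by simp))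
  rw [add_zero, mul_zero] at h3
  refine tendsto_of_tendsto_of_tendsto_of_le_of_le tendsto_const_nhds h3 (fun _ => zero_le)
    fun n => ?_
  have e : ENNReal.ofReal (Real.exp |a| * (n * (1 - (√(tiltZ P f a n))⁻¹) ^ 2))
      = ∫⁻ _, ENNReal.ofReal (Real.exp |a| * (n * (1 - (√(tiltZ P f a n))⁻¹) ^ 2)) ∂P := by simp
  dsimp only
  rw [e, ← lintegral_add_right _ measurable_const, ← lintegral_const_mul _ (by fun_prop)]
  refine lintegral_mono fun x => ?_
  rw [← ENNReal.ofReal_add (by positivity) (by positivity), two_mul_ofReal]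
  refine ENNReal.ofReal_le_ofReal ?_
  set w := a * trunc (f x / √(n : ℝ)) with hw
  rw [Real.sqrt_div (Real.exp_pos _).le, Real.exp_half w]
  have hE : √(Real.exp w) ^ 2 ≤ Real.exp |a| := by
    rw [Real.sq_sqrt (Real.exp_pos _).le]; exact exp_mul_trunc_le _ _
  set E := √(Real.exp w)
  set k := (√(tiltZ P f a n))⁻¹
  set y := 1 + 1 / 2 * (1 / √(n : ℝ)) * (a * f x)
  -- The error splits into that of the unnormalized exponential and that of the normalizing
  -- constant.
  have h5 : (y - E / √(tiltZ P f a n)) ^ 2 ≤ 2 * ((y - E) ^ 2 + E ^ 2 * (1 - k) ^ 2) := by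
    have : y - E / √(tiltZ P f a n) = (y - E) + E * (1 - k) := by
      simp only [k]; ring
    rw [this]; nlinarith [sq_nonneg ((y - E) - E * (1 - k))]
  have h6 := mul_le_mul_of_nonneg_right hE (sq_nonneg (1 - k))
  calc (n : ℝ) * (y - E / √(tiltZ P f a n)) ^ 2
      ≤ n * (2 * ((y - E) ^ 2 + Real.exp |a| * (1 - k) ^ 2)) := by gcongr; linarith
    _ = _ := by ring

end

lemma withDensity_ofReal_rnDeriv {μ ν : Measure Ω} [SigmaFinite μ] [SigmaFinite ν] (h : μ ≪ ν) :
    ν.withDensity (fun x => ENNReal.ofReal (μ.rnDeriv ν x).toReal) = μ := by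
  conv_rhs => rw [← Measure.withDensity_rnDeriv_eq μ ν h]
  refine withDensity_congr_ae ?_
  filter_upwards [μ.rnDeriv_lt_top ν] with x hx using ENNReal.ofReal_toReal hx.ne

/-- The powers of tests under local alternatives are asymptotically those under the tilts. -/
theorem IsLocalAlternative.tendsto_integral_sub_tilt {P : ProbabilityMeasure Ω}
    {ρ : Lp ℝ 2 (P : Measure Ω)} {Q : ℕ → ProbabilityMeasure Ω} (hQ : IsLocalAlternative P ρ Q)
    {f : Ω → ℝ} (hf : Measurable f) (hf2 : MemLp f 2 (P : Measure Ω))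
    (hf0 : ∫ x, f x ∂(P : Measure Ω) = 0) {a : ℝ} (hρ : ∀ᵐ x ∂(P : Measure Ω), ρ x = a * f x)
    {δ : ∀ n : ℕ, (Fin n → Ω) → ℝ} (hδ : IsAsymptoticTest δ) :
    Tendsto (fun n => ∫ x, δ n x ∂(iid (Q n) n)
      - ∫ x, δ n x ∂(Measure.pi fun _ : Fin n => tilt (P : Measure Ω) f a n)) atTop (𝓝 0) := by
  -- Both `√dQ_n` and the root of the tilt are compared with the linear expansion `(1 + ρ / (2√n))
  -- √dP`. By `(x + y) ^ 2 ≤ 2 x ^ 2 + 2 y ^ 2`, `D n` bounds `n` times their squared Hellinger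
  -- distance.
  set D : ℕ → ℝ≥0∞ := fun n => 2 * ((n : ℝ≥0∞) * sqrtDefect P (Q n) ρ (1 / √(n : ℝ))
    + ∫⁻ x, ENNReal.ofReal (n * (1 + 1 / 2 * (1 / √(n : ℝ)) * (a * f x)
      - √(Real.exp (a * trunc (f x / √(n : ℝ))) / tiltZ P f a n)) ^ 2) ∂(P : Measure Ω)) with hD
  have hD0 : Tendsto D atTop (𝓝 0) := by
    have := ENNReal.Tendsto.const_mul (a := 2)
      (Tendsto.add hQ (tendsto_natCast_mul_integral_tilt_defect hf hf2 hf0 a)) (Or.inr (by simp))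
    rw [add_zero, mul_zero] at this
    exact this
  have hDr : Tendsto (fun n => (D n).toReal) atTop (𝓝 0) := by
    exact (ENNReal.tendsto_toReal ENNReal.zero_ne_top).comp hD0
  have key : ∀ᶠ n in atTop, ∀ κ > 0, |∫ x, δ n x ∂(iid (Q n) n)
      - ∫ x, δ n x ∂(Measure.pi fun _ : Fin n => tilt (P : Measure Ω) f a n)|
      ≤ κ⁻¹ * (D n).toReal + 4 * κ := by
    filter_upwards [hD0.eventually (gt_mem_nhds ENNReal.zero_lt_top)] with n hn κ hκ
    let μ : Measure Ω := (P : Measure Ω) + (Q n : Measure Ω)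
    have hPμ : (P : Measure Ω) ≪ μ := Measure.AbsolutelyContinuous.rfl.add_right _
    have hQμ : (Q n : Measure Ω) ≪ μ := by
      simp only [μ]; rw [add_comm]; exact Measure.AbsolutelyContinuous.rfl.add_right _
    set p : Ω → ℝ := fun x => ((P : Measure Ω).rnDeriv μ x).toReal with hp
    set q : Ω → ℝ := fun x => ((Q n : Measure Ω).rnDeriv μ x).toReal with hq
    have hpm : Measurable p := (Measure.measurable_rnDeriv _ _).ennreal_toReal
    have hqm : Measurable q := (Measure.measurable_rnDeriv _ _).ennreal_toReal
    have hp0 : ∀ x, 0 ≤ p x := fun x => ENNReal.toReal_nonneg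
    have hq0 : ∀ x, 0 ≤ q x := fun x => ENNReal.toReal_nonneg
    have hPd : μ.withDensity (fun x => ENNReal.ofReal (p x)) = P := withDensity_ofReal_rnDeriv hPμ
    have hQd : μ.withDensity (fun x => ENNReal.ofReal (q x)) = Q n := withDensity_ofReal_rnDeriv hQμ
    set φ : Ω → ℝ := fun x => Real.exp (a * trunc (f x / √(n : ℝ))) / tiltZ P f a n with hφ
    have hZ := tiltZ_pos (P := (P : Measure Ω)) hf a n
    have hφ0 : ∀ x, 0 ≤ φ x := fun x => by simp only [hφ]; positivity
    have hφm : Measurable φ := by simp only [hφ]; fun_prop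
    have hφi : Integrable φ (P : Measure Ω) := (integrable_exp_mul_trunc hf a n).div_const _
    -- The tilt is also dominated by `P + Q n`, so both measures have densities with respect to one
    -- `μ`, and the part of `Q n` singular to `P` is kept.
    have hT : μ.withDensity (fun x => ENNReal.ofReal (p x * φ x)) = tilt P f a n := by
      have e : (fun x => ENNReal.ofReal (p x * φ x))
          = (fun x => ENNReal.ofReal (p x)) * fun x => ENNReal.ofReal (φ x) := by
        ext x; exact ENNReal.ofReal_mul (hp0 x)
      rw [e, withDensity_mul _ hpm.ennreal_ofReal hφm.ennreal_ofReal, hPd]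
      rfl
    have hpi : Integrable p μ := Measure.integrable_toReal_rnDeriv
    have hqi : Integrable q μ := Measure.integrable_toReal_rnDeriv
    have intP : ∀ g : Ω → ℝ, ∫ x, g x ∂(P : Measure Ω) = ∫ x, p x * g x ∂μ := fun g => by
      conv_lhs => rw [← hPd]
      exact integral_withDensity_ofReal hpm.aemeasurable hp0 g
    have hpφi : Integrable (fun x => p x * φ x) μ := by
      rw [← hPd, integrable_withDensity_iff hpm.ennreal_ofReal (ae_of_all _ fun _ => by simp)] at hφi
      simpa [ENNReal.toReal_ofReal, hp0, mul_comm] using hφi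
    have hq1 : ∫ x, q x ∂μ = 1 := by
      rw [hq, Measure.integral_toReal_rnDeriv hQμ]; simp
    have hpφ1 : ∫ x, p x * φ x ∂μ = 1 := by
      rw [← intP]; simp only [hφ]; rw [integral_div]; exact div_self hZ.ne'
    have hmain := abs_integral_pi_sub_le (μ := μ) hq0 (fun x => mul_nonneg (hp0 x) (hφ0 x)) hqi hpφi
      hq1 hpφ1 (hδ.measurable n)
      (fun x => abs_le.2 ⟨by linarith [(hδ.mem_Icc n x).1], (hδ.mem_Icc n x).2⟩) hκ
    rw [hQd, hT] at hmain
    refine hmain.trans (add_le_add_left (mul_le_mul_of_nonneg_left ?_ (inv_nonneg.2 hκ.le)) _)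
    rw [← integral_const_mul, integral_eq_lintegral_of_nonneg_ae (ae_of_all _ fun x => by positivity)
      (Measurable.aestronglyMeasurable (by fun_prop))]
    refine ENNReal.toReal_mono hn.ne ?_
    have hρm : Measurable ρ := (Lp.stronglyMeasurable ρ).measurable
    have lintP : ∀ g : Ω → ℝ≥0∞, Measurable g →
        ∫⁻ x, g x ∂(P : Measure Ω) = ∫⁻ x, ENNReal.ofReal (p x) * g x ∂μ := fun g hg => by
      conv_lhs => rw [← hPd]
      exact lintegral_withDensity_eq_lintegral_mul _ hpm.ennreal_ofReal hg
    have e1 : ∫⁻ x, ENNReal.ofReal (n * (1 + 1 / 2 * (1 / √(n : ℝ)) * (a * f x) - √(φ x)) ^ 2)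
          ∂(P : Measure Ω)
        = ∫⁻ x, ENNReal.ofReal (p x) * ENNReal.ofReal
          (n * (1 + 1 / 2 * (1 / √(n : ℝ)) * ρ x - √(φ x)) ^ 2) ∂μ := by
      rw [← lintP _ (Measurable.ennreal_ofReal (by fun_prop))]
      exact lintegral_congr_ae (hρ.mono fun x hx => by simp only [hx])
    have e2 : (n : ℝ≥0∞) * sqrtDefect P (Q n) ρ (1 / √(n : ℝ))
        = ∫⁻ x, ENNReal.ofReal (n * (√(q x) - (1 + 1 / 2 * (1 / √(n : ℝ)) * ρ x) * √(p x)) ^ 2) ∂μ := by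
      rw [sqrtDefect, ← lintegral_const_mul' _ _ (by simp)]
      refine lintegral_congr fun x => ?_
      rw [ENNReal.ofReal_mul (by positivity), ENNReal.ofReal_natCast]
    simp only [hD]
    rw [e1, e2, ← lintegral_add_left (Measurable.ennreal_ofReal (by fun_prop)),
      ← lintegral_const_mul' _ _ (by simp)]
    refine lintegral_mono fun x => ?_
    rw [← ENNReal.ofReal_mul (hp0 x), ← ENNReal.ofReal_add (by positivity)
      (mul_nonneg (hp0 x) (by positivity)), two_mul_ofReal]
    refine ENNReal.ofReal_le_ofReal ?_
    rw [Real.sqrt_mul (hp0 x)]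
    have hps : p x = √(p x) ^ 2 := (Real.sq_sqrt (hp0 x)).symm
    set v := 1 + 1 / 2 * (1 / √(n : ℝ)) * ρ x
    rw [hps, Real.sqrt_sq (Real.sqrt_nonneg _)]
    have h7 : (√(q x) - √(p x) * √(φ x)) ^ 2
        ≤ 2 * ((√(q x) - v * √(p x)) ^ 2 + √(p x) ^ 2 * (v - √(φ x)) ^ 2) := by
      nlinarith [sq_nonneg ((√(q x) - v * √(p x)) - √(p x) * (v - √(φ x)))]
    calc (n : ℝ) * (√(q x) - √(p x) * √(φ x)) ^ 2
        ≤ n * (2 * ((√(q x) - v * √(p x)) ^ 2 + √(p x) ^ 2 * (v - √(φ x)) ^ 2)) := by gcongr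
      _ = _ := by ring
  rw [tendsto_zero_iff_abs_tendsto_zero, Metric.tendsto_nhds]
  intro ε hε
  have hκ : (0 : ℝ) < ε / 8 := by positivity
  have hlim : Tendsto (fun n => (ε / 8)⁻¹ * (D n).toReal) atTop (𝓝 0) := by
    simpa using hDr.const_mul (ε / 8)⁻¹
  filter_upwards [key, hlim.eventually (gt_mem_nhds (show (0 : ℝ) < ε / 2 by positivity))] with n h1 h2
  have := h1 (ε / 8) hκ
  rw [Real.dist_eq, sub_zero]
  simp only [Function.comp, abs_abs]
  linarith

/-! ### Threshold tests and truncated sums -/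

/-- The standardized sum. -/
def stdSum (e : Ω → ℝ) (n : ℕ) (x : Fin n → Ω) : ℝ := (√(n : ℝ))⁻¹ * ∑ i, e (x i)

/-- The standardized sum of the truncated variables. -/
def truncSum (e : Ω → ℝ) (n : ℕ) (x : Fin n → Ω) : ℝ := ∑ i, trunc (e (x i) / √(n : ℝ))

/-- The test that rejects for values of the statistic `T` beyond `c`. -/
def thresholdTest (T : ∀ n : ℕ, (Fin n → Ω) → ℝ) (c : ℝ) (n : ℕ) (x : Fin n → Ω) : ℝ :=
  if c < T n x then 1 else 0

@[fun_prop]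
lemma measurable_stdSum {e : Ω → ℝ} (he : Measurable e) (n : ℕ) : Measurable (stdSum e n) := by
  unfold stdSum; fun_prop

@[fun_prop]
lemma measurable_truncSum {e : Ω → ℝ} (he : Measurable e) (n : ℕ) : Measurable (truncSum e n) := by
  unfold truncSum; fun_prop

lemma isAsymptoticTest_thresholdTest {T : ∀ n : ℕ, (Fin n → Ω) → ℝ} (hT : ∀ n, Measurable (T n))
    (c : ℝ) : IsAsymptoticTest (thresholdTest T c) where
  measurable n := Measurable.ite (measurableSet_lt measurable_const (hT n)) measurable_const
    measurable_const
  mem_Icc n x := by unfold thresholdTest; split_ifs <;> simp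

lemma integral_thresholdTest {T : ∀ n : ℕ, (Fin n → Ω) → ℝ} (hT : ∀ n, Measurable (T n))
    (c : ℝ) (n : ℕ) (m : Measure (Fin n → Ω)) :
    ∫ x, thresholdTest T c n x ∂m = m.real {x | c < T n x} := by
  rw [← integral_indicator_one (measurableSet_lt measurable_const (hT n))]
  rfl

lemma continuous_cdf_of_noAtoms (μ : Measure ℝ) [IsProbabilityMeasure μ] [NullSingletonClass μ] :
    Continuous (cdf μ) := by
  rw [continuous_iff_continuousAt]
  intro x
  rw [(monotone_cdf μ).continuousAt_iff_leftLim_eq_rightLim, StieltjesFunction.rightLim_eq]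
  have h : (cdf μ).measure {x} = 0 := by rw [measure_cdf]; exact measure_singleton x
  rw [StieltjesFunction.measure_singleton, ENNReal.ofReal_eq_zero, sub_nonpos] at h
  exact le_antisymm ((monotone_cdf μ).leftLim_le le_rfl) h

section
variable {P : Measure Ω} [IsProbabilityMeasure P] {e : Ω → ℝ}

/-- Limit theorems under `P` itself are the case `a = 0` of those under the tilts. -/
lemma tilt_zero (n : ℕ) : tilt P e 0 n = P := by
  unfold tilt
  simp

/-- The truncated function vanishes on the tail, so the density of the tilt is constant there. -/
lemma tilt_real_tail {P : Measure Ω} (he : Measurable e) (a : ℝ) (n : ℕ) :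
    (tilt P e a n).real {x | 1 < |e x / √(n : ℝ)|}
      = P.real {x | 1 < |e x / √(n : ℝ)|} / tiltZ P e a n := by
  have hA : MeasurableSet {x | 1 < |e x / √(n : ℝ)|} :=
    measurableSet_lt measurable_const (by fun_prop)
  rw [Measure.real, tilt, tilted_apply_eq_ofReal_integral' _ hA, ENNReal.toReal_ofReal
    (integral_nonneg fun x => by positivity)]
  have h : ∀ x ∈ {x | 1 < |e x / √(n : ℝ)|}, Real.exp (a * trunc (e x / √(n : ℝ)))
      / ∫ x, Real.exp (a * trunc (e x / √(n : ℝ))) ∂P = (tiltZ P e a n)⁻¹ := by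
    intro x hx
    rw [trunc, if_neg (not_le.2 hx), mul_zero, Real.exp_zero, one_div, tiltZ]
  rw [setIntegral_congr_fun hA h, setIntegral_const, smul_eq_mul, div_eq_mul_inv]

/-- Chebyshev's bound sharpened by dominated convergence: `n` times the indicator is at most `e ^ 2`
and is eventually zero at each point. -/
lemma tendsto_natCast_mul_tail {P : Measure Ω} (he : Measurable e) (he2 : MemLp e 2 P) :
    Tendsto (fun n : ℕ => n * P.real {x | 1 < |e x / √(n : ℝ)|}) atTop (𝓝 0) := by
  have hA : ∀ n : ℕ, MeasurableSet {x | 1 < |e x / √(n : ℝ)|} := fun n =>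
    measurableSet_lt measurable_const (by fun_prop)
  have h : Tendsto (fun n : ℕ => ∫ x, {x | 1 < |e x / √(n : ℝ)|}.indicator (fun _ => (n : ℝ)) x ∂P)
      atTop (𝓝 (∫ _, (0 : ℝ) ∂P)) := by
    refine tendsto_integral_of_dominated_convergence (fun x => e x ^ 2)
      (fun n => (measurable_const.indicator (hA n)).aestronglyMeasurable) he2.integrable_sq
      (fun n => ae_of_all _ fun x => ?_) (ae_of_all _ fun x => ?_)
    · by_cases hx : 1 < |e x / √(n : ℝ)|
      · rw [Set.indicator_of_mem (by exact hx), Real.norm_natCast]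
        rcases Nat.eq_zero_or_pos n with rfl | hn
        · simpa using sq_nonneg (e x)
        have hn0 : (0 : ℝ) < n := by exact_mod_cast hn
        have h1 : 1 < (e x / √(n : ℝ)) ^ 2 := by rw [← sq_abs]; nlinarith
        rw [div_pow, Real.sq_sqrt hn0.le, one_lt_div hn0] at h1
        exact h1.le
      · rw [Set.indicator_of_notMem (by exact hx), norm_zero]; positivity
    · refine tendsto_const_nhds.congr' ?_
      have ht : Tendsto (fun n : ℕ => |e x / √(n : ℝ)|) atTop (𝓝 0) := by
        simpa [div_eq_mul_inv] using (tendsto_inv_sqrt_natCast.const_mul (e x)).abs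
      filter_upwards [ht.eventually (eventually_le_nhds one_pos)] with n hn
      rw [Set.indicator_of_notMem (by simpa using hn)]
  rw [integral_zero] at h
  refine h.congr fun n => ?_
  rw [integral_indicator_const _ (hA n), smul_eq_mul, mul_comm]

lemma truncSum_eq_stdSum {Ω : Type*} {e : Ω → ℝ} {n : ℕ} {x : Fin n → Ω} (h : ∀ i, |e (x i) / √(n : ℝ)| ≤ 1) :
    truncSum e n x = stdSum e n x := by
  rw [truncSum, stdSum, Finset.mul_sum]
  exact Finset.sum_congr rfl fun i _ => by rw [trunc_of_abs_le (h i)]; ring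

/-- Truncation does not matter asymptotically. -/
lemma tendsto_truncSum_ne_stdSum (he : Measurable e) (he2 : MemLp e 2 P) (he0 : ∫ x, e x ∂P = 0)
    (a : ℝ) :
    Tendsto (fun n : ℕ => (Measure.pi fun _ : Fin n => tilt P e a n).real
      {x | truncSum e n x ≠ stdSum e n x}) atTop (𝓝 0) := by
  have hlim := (tendsto_natCast_mul_tail he he2).div (tendsto_tiltZ he he2 he0 a) one_ne_zero
  rw [zero_div] at hlim
  refine squeeze_zero (fun n => measureReal_nonneg) (fun n => ?_) hlim
  have := isProbabilityMeasure_tilt (P := P) he a n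
  have hA : MeasurableSet {x | 1 < |e x / √(n : ℝ)|} :=
    measurableSet_lt measurable_const (by fun_prop)
  have hsub : {x : Fin n → Ω | truncSum e n x ≠ stdSum e n x}
      ⊆ ⋃ i ∈ (Finset.univ : Finset (Fin n)), (fun x => x i) ⁻¹' {x | 1 < |e x / √(n : ℝ)|} := by
    intro x hx
    by_contra hcon
    refine hx (truncSum_eq_stdSum fun i => ?_)
    simp only [Finset.mem_univ, Set.iUnion_true, Set.mem_iUnion, not_exists, Set.mem_preimage,
      Set.mem_ofPred_eq, not_lt] at hcon
    exact hcon i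
  refine (measureReal_mono hsub (measure_ne_top _ _)).trans ((measureReal_biUnion_finset_le _ _).trans_eq ?_)
  have hi : ∀ i : Fin n, (Measure.pi fun _ : Fin n => tilt P e a n).real
      ((fun x => x i) ⁻¹' {x | 1 < |e x / √(n : ℝ)|})
      = P.real {x | 1 < |e x / √(n : ℝ)|} / tiltZ P e a n := by
    intro i
    rw [← tilt_real_tail he a n, Measure.real, Measure.real,
      (measurePreserving_eval (fun _ : Fin n => tilt P e a n) i).measure_preimage hA.nullMeasurableSet]
  simp only [hi]
  rw [Finset.sum_const, Finset.card_univ, Fintype.card_fin, nsmul_eq_mul, Pi.div_apply, mul_div_assoc]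

lemma abs_measureReal_gt_sub_le {X : Type*} [MeasurableSpace X] (m : Measure X)
    [IsFiniteMeasure m] (S T : X → ℝ) (c : ℝ) :
    |m.real {x | c < S x} - m.real {x | c < T x}| ≤ m.real {x | S x ≠ T x} := by
  have key : ∀ S T : X → ℝ, m.real {x | c < S x} ≤ m.real {x | c < T x} + m.real {x | S x ≠ T x} := by
    intro S T
    refine (measureReal_mono (fun x hx => ?_)).trans (measureReal_union_le _ _)
    by_cases h : S x = T x
    · left; simpa [← h] using hx
    · exact Or.inr h
  have h1 := key S T
  have h2 := key T S
  have e : {x | T x ≠ S x} = {x | S x ≠ T x} := by ext x; exact ne_comm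
  rw [e] at h2
  rw [abs_le]; constructor <;> linarith

/-- The likelihood ratio depends on `truncSum`, the test to be studied on `stdSum`. They coincide
with probability tending to one, so the limit law carries over. -/
lemma tendsto_tilt_truncSum_gt (he : Measurable e) (he2 : MemLp e 2 P) (he0 : ∫ x, e x ∂P = 0)
    (he1 : ∫ x, e x ^ 2 ∂P = 1) (a c : ℝ) :
    Tendsto (fun n : ℕ => (Measure.pi fun _ : Fin n => tilt P e a n).real {x | c < truncSum e n x})
      atTop (𝓝 (cdf (gaussianReal 0 1) (a - c))) := by
  have h1 := tendsto_tilt_sum_gt he he he2 he2 he0 he0 he1 a c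
  have e1 : ∫ x, e x * e x ∂P = 1 := by rw [← he1]; simp_rw [sq]
  rw [e1, mul_one] at h1
  refine tendsto_of_tendsto_of_dist h1 (squeeze_zero (fun _ => dist_nonneg) (fun n => ?_)
    (tendsto_truncSum_ne_stdSum he he2 he0 a))
  have := isProbabilityMeasure_tilt (P := P) he a n
  rw [dist_comm, Real.dist_eq]
  exact abs_measureReal_gt_sub_le _ (truncSum e n) (stdSum e n) c

/-! ### Neyman-Pearson theory for the tilts -/

/-- The density of the product of tilts. -/
def tiltDensity (P : Measure Ω) (e : Ω → ℝ) (a : ℝ) (n : ℕ) (x : Fin n → Ω) : ℝ :=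
  Real.exp (a * truncSum e n x) / tiltZ P e a n ^ n

lemma tiltDensity_pos (he : Measurable e) (a : ℝ) (n : ℕ) (x : Fin n → Ω) :
    0 < tiltDensity P e a n x :=
  div_pos (Real.exp_pos _) (pow_pos (tiltZ_pos he a n) n)

lemma tiltDensity_eq_prod {P : Measure Ω} (a : ℝ) (n : ℕ) (x : Fin n → Ω) :
    tiltDensity P e a n x = ∏ i, Real.exp (a * trunc (e (x i) / √(n : ℝ))) / tiltZ P e a n := by
  rw [Finset.prod_div_distrib, ← Real.exp_sum, ← Finset.mul_sum]
  simp [tiltDensity, truncSum]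

lemma integrable_tiltDensity (he : Measurable e) (a : ℝ) (n : ℕ) :
    Integrable (tiltDensity P e a n) (Measure.pi fun _ : Fin n => P) := by
  have : tiltDensity P e a n
      = fun x => ∏ i, Real.exp (a * trunc (e (x i) / √(n : ℝ))) / tiltZ P e a n := by
    ext x; exact tiltDensity_eq_prod a n x
  rw [this]
  exact Integrable.fintype_prod
    (f := fun _ y => Real.exp (a * trunc (e y / √(n : ℝ))) / tiltZ P e a n)
    fun _ => (integrable_exp_mul_trunc he a n).div_const _

lemma integral_pi_tilt (he : Measurable e) (a : ℝ) (n : ℕ) (δ : (Fin n → Ω) → ℝ) :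
    ∫ x, δ x ∂(Measure.pi fun _ : Fin n => tilt P e a n)
      = ∫ x, tiltDensity P e a n x * δ x ∂(Measure.pi fun _ : Fin n => P) := by
  rw [← integral_withDensity_ofReal (integrable_tiltDensity he a n).1.aemeasurable
    fun x => (tiltDensity_pos he a n x).le]
  congr 1
  have h := pi_withDensity_ofReal (μ := P)
    (f := fun x => Real.exp (a * trunc (e x / √(n : ℝ))) / tiltZ P e a n)
    (fun x => div_nonneg (Real.exp_pos _).le (tiltZ_pos he a n).le)
    ((integrable_exp_mul_trunc he a n).div_const _) n
  simp_rw [tiltDensity_eq_prod]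
  exact h

/-- The critical value of the likelihood ratio test. -/
def critValue (P : Measure Ω) (e : Ω → ℝ) (a b c : ℝ) (n : ℕ) : ℝ :=
  Real.exp ((b - a) * c) * tiltZ P e a n ^ n / tiltZ P e b n ^ n

/-- A finite limit ensures that an asymptotically vanishing excess of level costs only a vanishing
amount of power. -/
lemma tendsto_critValue (he : Measurable e) (he2 : MemLp e 2 P) (he0 : ∫ x, e x ∂P = 0)
    (a b c : ℝ) : ∃ k, 0 ≤ k ∧ Tendsto (critValue P e a b c) atTop (𝓝 k) :=
  ⟨_, by positivity, ((tendsto_tiltZ_pow he he2 he0 a).const_mul (Real.exp ((b - a) * c))).div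
    (tendsto_tiltZ_pow he he2 he0 b) (Real.exp_pos _).ne'⟩

/-- For `a < b` the right side has the sign of `truncSum - c`. The threshold test at `c` is
therefore exactly the likelihood ratio test with this critical value. -/
lemma tiltDensity_sub (he : Measurable e) (a b c : ℝ) (n : ℕ) (x : Fin n → Ω) :
    tiltDensity P e b n x - critValue P e a b c n * tiltDensity P e a n x
      = (tiltZ P e b n ^ n)⁻¹ * Real.exp (b * truncSum e n x)
        * (1 - Real.exp (-((b - a) * (truncSum e n x - c)))) := by
  have ha := pow_pos (tiltZ_pos (P := P) he a n) n
  have hb := pow_pos (tiltZ_pos (P := P) he b n) n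
  unfold tiltDensity critValue
  have e1 : Real.exp (b * truncSum e n x) * Real.exp (-((b - a) * (truncSum e n x - c)))
      = Real.exp ((b - a) * c) * Real.exp (a * truncSum e n x) := by
    rw [← Real.exp_add, ← Real.exp_add]; ring_nf
  rw [mul_assoc, mul_sub, e1]
  field_simp

/-- The Neyman-Pearson identity for the truncated likelihood ratio tests. -/
lemma neymanPearson_identity (he : Measurable e) {a b : ℝ} (hab : a < b) (c : ℝ) (n : ℕ)
    {δ : (Fin n → Ω) → ℝ} (hδ : Measurable δ) (hδ1 : ∀ x, δ x ∈ Set.Icc (0 : ℝ) 1) :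
    Integrable (fun x => |thresholdTest (truncSum e) c n x - δ x|
        * |tiltDensity P e b n x - critValue P e a b c n * tiltDensity P e a n x|)
        (Measure.pi fun _ : Fin n => P) ∧
    ∫ x, |thresholdTest (truncSum e) c n x - δ x|
        * |tiltDensity P e b n x - critValue P e a b c n * tiltDensity P e a n x|
        ∂(Measure.pi fun _ : Fin n => P)
      = (∫ x, thresholdTest (truncSum e) c n x ∂(Measure.pi fun _ : Fin n => tilt P e b n)
          - ∫ x, δ x ∂(Measure.pi fun _ : Fin n => tilt P e b n))
        - critValue P e a b c n *
          (∫ x, thresholdTest (truncSum e) c n x ∂(Measure.pi fun _ : Fin n => tilt P e a n)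
          - ∫ x, δ x ∂(Measure.pi fun _ : Fin n => tilt P e a n)) := by
  have hT := isAsymptoticTest_thresholdTest (fun n => measurable_truncSum he n) c
  have hbd : ∀ (η : (Fin n → Ω) → ℝ), Measurable η → (∀ x, η x ∈ Set.Icc (0 : ℝ) 1) → ∀ s,
      Integrable (fun x => tiltDensity P e s n x * η x) (Measure.pi fun _ : Fin n => P) := by
    intro η hη h1 s
    exact (integrable_tiltDensity he s n).mul_bdd (c := 1) hη.aestronglyMeasurable
      (ae_of_all _ fun x => abs_le.2 ⟨by linarith [(h1 x).1], (h1 x).2⟩)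
  have hpt : ∀ x, |thresholdTest (truncSum e) c n x - δ x|
        * |tiltDensity P e b n x - critValue P e a b c n * tiltDensity P e a n x|
      = (tiltDensity P e b n x * thresholdTest (truncSum e) c n x - tiltDensity P e b n x * δ x)
        - critValue P e a b c n * (tiltDensity P e a n x * thresholdTest (truncSum e) c n x
          - tiltDensity P e a n x * δ x) := by
    intro x
    rw [← abs_mul]
    -- Both factors have the same sign, so the product of absolute values is the product itself,
    -- which is linear in the tests.
    trans (thresholdTest (truncSum e) c n x - δ x)
      * (tiltDensity P e b n x - critValue P e a b c n * tiltDensity P e a n x)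
    swap
    · ring
    refine abs_of_nonneg ?_
    rw [tiltDensity_sub he]
    have hb := inv_pos.2 (pow_pos (tiltZ_pos (P := P) he b n) n)
    unfold thresholdTest
    split_ifs with h
    · refine mul_nonneg (by linarith [(hδ1 x).2]) (mul_nonneg (by positivity) ?_)
      rw [sub_nonneg, Real.exp_le_one_iff, neg_nonpos]
      exact mul_nonneg (by linarith) (by linarith)
    · refine mul_nonneg_of_nonpos_of_nonpos (by linarith [(hδ1 x).1])
        (mul_nonpos_of_nonneg_of_nonpos (by positivity) ?_)
      rw [sub_nonpos, Real.one_le_exp_iff, neg_nonneg]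
      exact mul_nonpos_of_nonneg_of_nonpos (by linarith) (by linarith)
  simp_rw [hpt, integral_pi_tilt he]
  have i1 := hbd _ (hT.measurable n) (hT.mem_Icc n) b
  have i2 := hbd _ hδ hδ1 b
  have i3 := hbd _ (hT.measurable n) (hT.mem_Icc n) a
  have i4 := hbd _ hδ hδ1 a
  have i12 : Integrable (fun x => tiltDensity P e b n x * thresholdTest (truncSum e) c n x
    - tiltDensity P e b n x * δ x) (Measure.pi fun _ : Fin n => P) := i1.sub i2
  have i34 : Integrable (fun x => critValue P e a b c n *
    (tiltDensity P e a n x * thresholdTest (truncSum e) c n x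
    - tiltDensity P e a n x * δ x)) (Measure.pi fun _ : Fin n => P) := (i3.sub i4).const_mul _
  refine ⟨i12.sub i34, ?_⟩
  rw [integral_sub i12 i34, integral_const_mul, integral_sub i1 i2, integral_sub i3 i4]

lemma tendsto_integral_threshold_truncSum (he : Measurable e) (he2 : MemLp e 2 P)
    (he0 : ∫ x, e x ∂P = 0) (he1 : ∫ x, e x ^ 2 ∂P = 1) (a c : ℝ) :
    Tendsto (fun n : ℕ => ∫ x, thresholdTest (truncSum e) c n x
      ∂(Measure.pi fun _ : Fin n => tilt P e a n)) atTop (𝓝 (cdf (gaussianReal 0 1) (a - c))) := by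
  simp_rw [integral_thresholdTest (fun n => measurable_truncSum he n)]
  exact tendsto_tilt_truncSum_gt he he2 he0 he1 a c

/-- Tests of asymptotic level have at most the asymptotic power of the likelihood ratio test. -/
theorem eventually_integral_le_of_level (he : Measurable e) (he2 : MemLp e 2 P)
    (he0 : ∫ x, e x ∂P = 0) (he1 : ∫ x, e x ^ 2 ∂P = 1) {a b : ℝ} (hab : a < b) (c : ℝ)
    {δ : ∀ n : ℕ, (Fin n → Ω) → ℝ} (hδ : IsAsymptoticTest δ)
    (hlevel : ∀ ε > 0, ∀ᶠ n in atTop, ∫ x, δ n x ∂(Measure.pi fun _ : Fin n => tilt P e a n)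
      ≤ cdf (gaussianReal 0 1) (a - c) + ε) :
    ∀ ε > 0, ∀ᶠ n in atTop, ∫ x, δ n x ∂(Measure.pi fun _ : Fin n => tilt P e b n)
      ≤ cdf (gaussianReal 0 1) (b - c) + ε := by
  intro ε hε
  obtain ⟨k, hk0, hk⟩ := tendsto_critValue he he2 he0 a b c
  have hA := tendsto_integral_threshold_truncSum he he2 he0 he1 a c
  have hB := tendsto_integral_threshold_truncSum he he2 he0 he1 b c
  set A := cdf (gaussianReal 0 1) (a - c)
  set B := cdf (gaussianReal 0 1) (b - c)
  -- The excess of level is multiplied by the limiting critical value `k`; `k + 1` keeps the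
  -- denominator positive when `k = 0`.
  set η := ε / (2 * (k + 1)) with hη
  have hη0 : 0 < η := by positivity
  have hlim := hB.add (hk.mul ((tendsto_const_nhds (x := A + η)).sub hA))
  have hlt : B + k * (A + η - A) < B + ε := by
    have : k * η ≤ ε / 2 := by
      rw [hη]
      have : k * (ε / (2 * (k + 1))) = ε / 2 * (k / (k + 1)) := by field_simp
      rw [this]
      exact mul_le_of_le_one_right (by positivity) ((div_le_one (by positivity)).2 (by linarith))
    rw [add_sub_cancel_left]; linarith
  filter_upwards [hlim.eventually (gt_mem_nhds hlt), hlevel η hη0] with n h1 h2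
  have hnp := (neymanPearson_identity (P := P) he hab c n (hδ.measurable n) (hδ.mem_Icc n)).2
  have hpos : 0 ≤ ∫ x, |thresholdTest (truncSum e) c n x - δ n x|
        * |tiltDensity P e b n x - critValue P e a b c n * tiltDensity P e a n x|
        ∂(Measure.pi fun _ : Fin n => P) := integral_nonneg fun x => by positivity
  have hc : 0 ≤ critValue P e a b c n := by
    have := tiltZ_pos (P := P) he a n
    have := tiltZ_pos (P := P) he b n
    unfold critValue; positivity
  nlinarith [mul_le_mul_of_nonneg_left h2 hc]

/-- In `neymanPearson_identity` the power deficit and the weighted level excess are both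
asymptotically at most zero, while the integral is nonnegative. -/
lemma tendsto_neymanPearson_gap (he : Measurable e) (he2 : MemLp e 2 P)
    (he0 : ∫ x, e x ∂P = 0) (he1 : ∫ x, e x ^ 2 ∂P = 1) {a b : ℝ} (hab : a < b) (c : ℝ)
    {δ : ∀ n : ℕ, (Fin n → Ω) → ℝ} (hδ : IsAsymptoticTest δ)
    (hlevel : ∀ ε > 0, ∀ᶠ n in atTop, ∫ x, δ n x ∂(Measure.pi fun _ : Fin n => tilt P e a n)
      ≤ cdf (gaussianReal 0 1) (a - c) + ε)
    (hpower : ∀ ε > 0, ∀ᶠ n in atTop, cdf (gaussianReal 0 1) (b - c) - ε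
      ≤ ∫ x, δ n x ∂(Measure.pi fun _ : Fin n => tilt P e b n)) :
    Tendsto (fun n : ℕ => ∫ x, |thresholdTest (truncSum e) c n x - δ n x|
        * |tiltDensity P e b n x - critValue P e a b c n * tiltDensity P e a n x|
        ∂(Measure.pi fun _ : Fin n => P)) atTop (𝓝 0) := by
  obtain ⟨k, hk0, hk⟩ := tendsto_critValue he he2 he0 a b c
  have hA := tendsto_integral_threshold_truncSum he he2 he0 he1 a c
  have hB := tendsto_integral_threshold_truncSum he he2 he0 he1 b c
  set A := cdf (gaussianReal 0 1) (a - c)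
  set B := cdf (gaussianReal 0 1) (b - c)
  rw [Metric.tendsto_nhds]
  intro ε hε
  set η := ε / (2 * (k + 1)) with hη
  have hη0 : 0 < η := by positivity
  have hlim := (hB.sub (tendsto_const_nhds (x := B - η))).add
    (hk.mul ((tendsto_const_nhds (x := A + η)).sub hA))
  have hlt : B - (B - η) + k * (A + η - A) < ε := by
    have : η * (2 * (k + 1)) = ε := div_mul_cancel₀ _ (by positivity)
    rw [add_sub_cancel_left]; nlinarith
  filter_upwards [hlim.eventually (gt_mem_nhds hlt), hlevel η hη0, hpower η hη0] with n h1 h2 h3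
  rw [Real.dist_eq, sub_zero, abs_of_nonneg (integral_nonneg fun x => by positivity),
    (neymanPearson_identity (P := P) he hab c n (hδ.measurable n) (hδ.mem_Icc n)).2]
  have hc : 0 ≤ critValue P e a b c n := by
    have := tiltZ_pos (P := P) he a n
    have := tiltZ_pos (P := P) he b n
    unfold critValue; positivity
  nlinarith [mul_le_mul_of_nonneg_left h2 hc]

/-! ### Agreement in probability of optimal tests -/

/-- The side `y ≥ 0` is the worse one; on the other side `exp η + exp (-η) ≥ 2` suffices. -/
lemma le_abs_one_sub_exp_neg {y η : ℝ} (h : η ≤ |y|) :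
    1 - Real.exp (-η) ≤ |1 - Real.exp (-y)| := by
  rcases le_total 0 y with hy | hy
  · rw [abs_of_nonneg hy] at h
    refine le_trans ?_ (le_abs_self _)
    have := Real.exp_le_exp.2 (neg_le_neg h)
    linarith
  · rw [abs_of_nonpos hy] at h
    refine le_trans ?_ (neg_le_abs _)
    have h1 := Real.exp_le_exp.2 h
    have h2 : 2 ≤ Real.exp η + Real.exp (-η) := by
      linarith [Real.add_one_le_exp η, Real.add_one_le_exp (-η)]
    linarith

/-- These are the limiting masses of the regions where the Neyman-Pearson integrand has no useful
lower bound: large values of the statistic, and values close to `c`. -/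
lemma exists_small_tails {ε : ℝ} (hε : 0 < ε) (c : ℝ) : ∃ M η : ℝ, 0 < M ∧ 0 < η ∧
    (1 - cdf (gaussianReal 0 1) M) + cdf (gaussianReal 0 1) (-M)
      + (cdf (gaussianReal 0 1) (-(c - η)) - cdf (gaussianReal 0 1) (-(c + η))) < ε := by
  have : NullSingletonClass (gaussianReal 0 1) := nullSingletonClass_gaussianReal one_ne_zero
  have hc := continuous_cdf_of_noAtoms (gaussianReal 0 1)
  have h1 : Tendsto (fun M => (1 - cdf (gaussianReal 0 1) M) + cdf (gaussianReal 0 1) (-M)) atTop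
      (𝓝 0) := by
    simpa using ((tendsto_const_nhds (x := (1 : ℝ))).sub (tendsto_cdf_atTop (gaussianReal 0 1))).add
      ((tendsto_cdf_atBot (gaussianReal 0 1)).comp tendsto_neg_atTop_atBot)
  have h2 : Tendsto (fun η => cdf (gaussianReal 0 1) (-(c - η)) - cdf (gaussianReal 0 1) (-(c + η)))
      (𝓝[>] 0) (𝓝 0) := by
    have : Continuous fun η =>
        cdf (gaussianReal 0 1) (-(c - η)) - cdf (gaussianReal 0 1) (-(c + η)) := by fun_prop
    exact (this.tendsto' 0 0 (by simp)).mono_left nhdsWithin_le_nhds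
  obtain ⟨M, hM, hM0⟩ :=
    ((h1.eventually (gt_mem_nhds (half_pos hε))).and (eventually_gt_atTop 0)).exists
  obtain ⟨η, hη, hη0⟩ :=
    ((h2.eventually (gt_mem_nhds (half_pos hε))).and self_mem_nhdsWithin).exists
  exact ⟨M, η, hM0, hη0, by linarith⟩

/-- Asymptotically optimal tests coincide with the likelihood ratio test in probability. -/
theorem tendsto_measure_sub_thresholdTest (he : Measurable e) (he2 : MemLp e 2 P)
    (he0 : ∫ x, e x ∂P = 0) (he1 : ∫ x, e x ^ 2 ∂P = 1) {a b : ℝ} (hab : a < b) (c : ℝ)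
    {δ : ∀ n : ℕ, (Fin n → Ω) → ℝ} (hδ : IsAsymptoticTest δ)
    (hlevel : ∀ ε > 0, ∀ᶠ n in atTop, ∫ x, δ n x ∂(Measure.pi fun _ : Fin n => tilt P e a n)
      ≤ cdf (gaussianReal 0 1) (a - c) + ε)
    (hpower : ∀ ε > 0, ∀ᶠ n in atTop, cdf (gaussianReal 0 1) (b - c) - ε
      ≤ ∫ x, δ n x ∂(Measure.pi fun _ : Fin n => tilt P e b n)) {ε : ℝ} (hε : 0 < ε) :
    Tendsto (fun n : ℕ => (Measure.pi fun _ : Fin n => P)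
      {x | ε ≤ |δ n x - thresholdTest (stdSum e) c n x|}) atTop (𝓝 0) := by
  suffices h : Tendsto (fun n : ℕ => (Measure.pi fun _ : Fin n => P).real
      {x | ε ≤ |δ n x - thresholdTest (stdSum e) c n x|}) atTop (𝓝 0) by
    have := ENNReal.tendsto_ofReal h
    simpa [Measure.real, ENNReal.ofReal_toReal] using this
  have hgap := tendsto_neymanPearson_gap he he2 he0 he1 hab c hδ hlevel hpower
  have hne := tendsto_truncSum_ne_stdSum he he2 he0 0
  have hgt := fun t => tendsto_tilt_truncSum_gt he he2 he0 he1 0 t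
  simp only [tilt_zero, zero_sub] at hne hgt
  have hZ := tendsto_tiltZ_pow he he2 he0 b
  rw [Metric.tendsto_nhds]
  intro ε' hε'
  obtain ⟨M, η, hM, hη, hsmall⟩ := exists_small_tails hε' c
  -- Lower bound for `tiltZ ^ n` times the modulus in `tiltDensity_sub` where `|truncSum| ≤ M` and
  -- `|truncSum - c| ≥ η`.
  set w : ℝ := Real.exp (-(|b| * M)) * (1 - Real.exp (-((b - a) * η))) with hw
  have hw0 : 0 < w := by
    have : Real.exp (-((b - a) * η)) < 1 := Real.exp_lt_one_iff.2 (by nlinarith)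
    exact mul_pos (Real.exp_pos _) (by linarith)
  have hlim := (((hgap.mul hZ).mul_const (ε * w)⁻¹).add hne).add
    (((hgt M).add ((tendsto_const_nhds (x := (1 : ℝ))).sub (hgt (-M)))).add
      ((hgt (c - η)).sub (hgt (c + η))))
  have hlt : 0 * Real.exp (b ^ 2 / 2 * ∫ x, e x ^ 2 ∂P) * (ε * w)⁻¹ + 0
      + (cdf (gaussianReal 0 1) (-M) + (1 - cdf (gaussianReal 0 1) (- -M))
        + (cdf (gaussianReal 0 1) (-(c - η)) - cdf (gaussianReal 0 1) (-(c + η)))) < ε' := by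
    rw [neg_neg]; linarith
  filter_upwards [hlim.eventually (gt_mem_nhds hlt)] with n hn
  rw [Real.dist_eq, sub_zero, abs_of_nonneg measureReal_nonneg]
  refine lt_of_le_of_lt ?_ hn
  set m := Measure.pi fun _ : Fin n => P with hm
  have hTm := measurable_truncSum he n
  set G : Set (Fin n → Ω) := {x | ε ≤ |thresholdTest (truncSum e) c n x - δ n x|
    ∧ |truncSum e n x| ≤ M ∧ η ≤ |truncSum e n x - c|} with hG
  have hdev : m.real G ≤ (∫ x, |thresholdTest (truncSum e) c n x - δ n x|
        * |tiltDensity P e b n x - critValue P e a b c n * tiltDensity P e a n x| ∂m)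
        * tiltZ P e b n ^ n * (ε * w)⁻¹ := by
    have hZn := pow_pos (tiltZ_pos (P := P) he b n) n
    have hi := (neymanPearson_identity (P := P) he hab c n (hδ.measurable n) (hδ.mem_Icc n)).1
    -- Markov's inequality: on `G` the integrand exceeds a fixed level up to the convergent factor
    -- `tiltZ ^ n`, so a vanishing gap forces `G` to be negligible.
    have hmk := mul_meas_ge_le_integral_of_nonneg (μ := m) (ae_of_all _ fun x => by positivity) hi
      (ε * w * (tiltZ P e b n ^ n)⁻¹)
    have hsub : G ⊆ {x | ε * w * (tiltZ P e b n ^ n)⁻¹ ≤ |thresholdTest (truncSum e) c n x - δ n x|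
        * |tiltDensity P e b n x - critValue P e a b c n * tiltDensity P e a n x|} := by
      rintro x ⟨h1, h2, h3⟩
      simp only [Set.mem_ofPred_eq]
      rw [tiltDensity_sub he, abs_mul, abs_mul, abs_of_pos (inv_pos.2 hZn),
        abs_of_pos (Real.exp_pos _), mul_assoc]
      refine mul_le_mul h1 ?_ (by positivity) (abs_nonneg _)
      rw [mul_comm, hw, mul_assoc]
      refine mul_le_mul_of_nonneg_left ?_ (inv_nonneg.2 hZn.le)
      refine mul_le_mul (Real.exp_le_exp.2 ?_) (le_abs_one_sub_exp_neg ?_) ?_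
        (Real.exp_pos _).le
      · refine neg_le_of_abs_le ?_
        rw [abs_mul]
        exact mul_le_mul_of_nonneg_left h2 (abs_nonneg _)
      · rw [abs_mul, abs_of_pos (sub_pos.2 hab)]
        exact mul_le_mul_of_nonneg_left h3 (sub_pos.2 hab).le
      · have : Real.exp (-((b - a) * η)) < 1 := Real.exp_lt_one_iff.2 (by nlinarith)
        linarith
    have h4 := (mul_le_mul_of_nonneg_left (measureReal_mono (μ := m) hsub)
      (show 0 ≤ ε * w * (tiltZ P e b n ^ n)⁻¹ by positivity)).trans hmk
    rw [← div_eq_mul_inv, le_div_iff₀ (by positivity)]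
    calc m.real G * (ε * w) = (ε * w * (tiltZ P e b n ^ n)⁻¹ * m.real G) * tiltZ P e b n ^ n := by
          field_simp
      _ ≤ _ := by gcongr
  have hMm : m.real {x | truncSum e n x ≤ -M} = 1 - m.real {x | -M < truncSum e n x} := by
    rw [← probReal_compl_eq_one_sub (measurableSet_lt measurable_const hTm)]
    congr 1; ext x; simp
  have hmid : m.real {x | c - η < truncSum e n x ∧ truncSum e n x ≤ c + η}
      = m.real {x | c - η < truncSum e n x} - m.real {x | c + η < truncSum e n x} := by
    rw [← measureReal_sdiff (fun x hx => by simp only [Set.mem_ofPred_eq] at *; linarith)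
      (measurableSet_lt measurable_const hTm)]
    congr 1; ext x; simp
  have hcover : {x | ε ≤ |δ n x - thresholdTest (stdSum e) c n x|}
      ⊆ (G ∪ {x | truncSum e n x ≠ stdSum e n x}) ∪
        (({x | M < truncSum e n x} ∪ {x | truncSum e n x ≤ -M})
          ∪ {x | c - η < truncSum e n x ∧ truncSum e n x ≤ c + η}) := by
    intro x hx
    by_contra hcon
    simp only [Set.mem_union, not_or, Set.mem_ofPred_eq, not_lt, not_le, not_and, hG, ne_eq,
      not_not] at hcon hx
    obtain ⟨⟨hg, heq⟩, ⟨h1, h2⟩, h3⟩ := hcon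
    have : thresholdTest (stdSum e) c n x = thresholdTest (truncSum e) c n x := by
      simp only [thresholdTest, heq]
    rw [this, abs_sub_comm] at hx
    have h4 := hg hx (abs_le.2 ⟨h2.le, h1⟩)
    rw [abs_lt] at h4
    have := h3 (by linarith)
    linarith
  refine (measureReal_mono hcover).trans ?_
  rw [← hMm, ← hmid]
  refine (measureReal_union_le _ _).trans (add_le_add ((measureReal_union_le _ _).trans
    (add_le_add hdev le_rfl)) ((measureReal_union_le _ _).trans
    (add_le_add (measureReal_union_le _ _) le_rfl)))
end

/-! ### Asymptotic size and power, and the maxmin property -/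

section
variable {P : ProbabilityMeasure Ω} {e : Ω → ℝ}

lemma iid_isProbabilityMeasure (Q : ProbabilityMeasure Ω) (n : ℕ) : IsProbabilityMeasure (iid Q n) := by
  unfold iid; infer_instance

lemma IsAsymptoticTest.integral_mem_Icc {δ : ∀ n : ℕ, (Fin n → Ω) → ℝ} (hδ : IsAsymptoticTest δ)
    (Q : ℕ → ProbabilityMeasure Ω) (n : ℕ) : ∫ x, δ n x ∂(iid (Q n) n) ∈ Set.Icc (0 : ℝ) 1 := by
  have := iid_isProbabilityMeasure (Q n) n
  refine ⟨integral_nonneg fun x => (hδ.mem_Icc n x).1, ?_⟩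
  have hi : Integrable (δ n) (iid (Q n) n) := Integrable.of_bound
    (hδ.measurable n).aestronglyMeasurable 1
    (ae_of_all _ fun x => abs_le.2 ⟨by linarith [(hδ.mem_Icc n x).1], (hδ.mem_Icc n x).2⟩)
  refine (integral_mono hi (integrable_const 1) fun x => (hδ.mem_Icc n x).2).trans_eq (by simp)

lemma isBoundedUnder_le_of_mem_Icc {s : ℕ → ℝ} (h : ∀ n, s n ∈ Set.Icc (0 : ℝ) 1) :
    IsBoundedUnder (· ≤ ·) atTop s := isBoundedUnder_of ⟨1, fun n => (h n).2⟩

lemma isBoundedUnder_ge_of_mem_Icc {s : ℕ → ℝ} (h : ∀ n, s n ∈ Set.Icc (0 : ℝ) 1) :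
    IsBoundedUnder (· ≥ ·) atTop s := isBoundedUnder_of ⟨0, fun n => (h n).1⟩

lemma limsup_le_one_of_mem_Icc {s : ℕ → ℝ} (h : ∀ n, s n ∈ Set.Icc (0 : ℝ) 1) :
    limsup s atTop ≤ 1 :=
  limsup_le_of_le (isBoundedUnder_ge_of_mem_Icc h).isCoboundedUnder_le (Eventually.of_forall fun n => (h n).2)

lemma liminf_nonneg_of_mem_Icc {s : ℕ → ℝ} (h : ∀ n, s n ∈ Set.Icc (0 : ℝ) 1) :
    0 ≤ liminf s atTop :=
  le_liminf_of_le (isBoundedUnder_le_of_mem_Icc h).isCoboundedUnder_ge (Eventually.of_forall fun n => (h n).1)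

variable {Pn : Lp ℝ 2 (P : Measure Ω) → ℕ → ProbabilityMeasure Ω}
  {G G₀ G₁ : Set (Lp ℝ 2 (P : Measure Ω))}

lemma limsup_le_asympSize {δ : ∀ n : ℕ, (Fin n → Ω) → ℝ} (hδ : IsAsymptoticTest δ)
    {g : Lp ℝ 2 (P : Measure Ω)} (hg : g ∈ G) :
    limsup (fun n : ℕ => ∫ x, δ n x ∂(iid (Pn g n) n)) atTop ≤ asympSize Pn G δ := by
  refine le_ciSup (f := fun g : G => limsup (fun n : ℕ => ∫ x, δ n x ∂(iid (Pn g n) n)) atTop)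
    ⟨1, ?_⟩ ⟨g, hg⟩
  rintro _ ⟨h, rfl⟩
  exact limsup_le_one_of_mem_Icc fun n => hδ.integral_mem_Icc _ n

lemma asympPower_le_liminf {δ : ∀ n : ℕ, (Fin n → Ω) → ℝ} (hδ : IsAsymptoticTest δ)
    {g : Lp ℝ 2 (P : Measure Ω)} (hg : g ∈ G) :
    asympPower Pn G δ ≤ liminf (fun n : ℕ => ∫ x, δ n x ∂(iid (Pn g n) n)) atTop := by
  refine ciInf_le (f := fun g : G => liminf (fun n : ℕ => ∫ x, δ n x ∂(iid (Pn g n) n)) atTop)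
    ⟨0, ?_⟩ ⟨g, hg⟩
  rintro _ ⟨h, rfl⟩
  exact liminf_nonneg_of_mem_Icc fun n => hδ.integral_mem_Icc _ n

/-- Asymptotic power of the one-sided linear test under local alternatives. -/
theorem IsLocalAlternative.tendsto_integral {g : Lp ℝ 2 (P : Measure Ω)}
    {Q : ℕ → ProbabilityMeasure Ω} (hQ : IsLocalAlternative P g Q)
    (hg0 : ∫ x, g x ∂(P : Measure Ω) = 0) (he : Measurable e) (he2 : MemLp e 2 (P : Measure Ω))
    (he0 : ∫ x, e x ∂(P : Measure Ω) = 0) (he1 : ∫ x, e x ^ 2 ∂(P : Measure Ω) = 1) {c : ℝ}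
    {ψ : ∀ n : ℕ, (Fin n → Ω) → ℝ} (hψ : IsAsymptoticTest ψ)
    (hψe : ∀ n, ψ n =ᵐ[iid P n] thresholdTest (stdSum e) c n) :
    Tendsto (fun n => ∫ x, ψ n x ∂(iid (Q n) n)) atTop
      (𝓝 (cdf (gaussianReal 0 1) (∫ x, g x * e x ∂(P : Measure Ω) - c))) := by
  have hgm : Measurable g := (Lp.stronglyMeasurable g).measurable
  -- The tilt is taken in the direction `g` itself; its inner product with `e` becomes the shift of
  -- the mean.
  have h1 := hQ.tendsto_integral_sub_tilt hgm (Lp.memLp g) hg0 (a := 1)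
    (ae_of_all _ fun x => (one_mul _).symm) hψ
  have h2 := tendsto_tilt_sum_gt hgm he (Lp.memLp g) he2 hg0 he0 he1 1 c
  rw [one_mul] at h2
  refine ((h1.add h2).congr fun n => ?_).trans_eq (by rw [zero_add])
  have h3 : ∫ x, ψ n x ∂(Measure.pi fun _ : Fin n => tilt (P : Measure Ω) g 1 n)
      = (Measure.pi fun _ : Fin n => tilt (P : Measure Ω) g 1 n).real {x | c < stdSum e n x} := by
    -- Tilted products have densities with respect to `P^n`, so equality `P^n` almost everywhere is
    -- enough.
    rw [← integral_thresholdTest (fun n => measurable_stdSum he n) c, integral_pi_tilt hgm,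
      integral_pi_tilt hgm]
    refine integral_congr_ae ?_
    filter_upwards [hψe n] with x hx
    rw [hx]
  rw [h3]
  simp only [stdSum]
  ring

lemma IsLocalAlternative.eventually_le_tilt {q : Lp ℝ 2 (P : Measure Ω)}
    {Q : ℕ → ProbabilityMeasure Ω} (hQ : IsLocalAlternative P q Q) (he : Measurable e)
    (he2 : MemLp e 2 (P : Measure Ω)) (he0 : ∫ x, e x ∂(P : Measure Ω) = 0) {a : ℝ}
    (hq : ∀ᵐ x ∂(P : Measure Ω), q x = a * e x)
    {δ : ∀ n : ℕ, (Fin n → Ω) → ℝ} (hδ : IsAsymptoticTest δ) {ε : ℝ} (hε : 0 < ε) :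
    ∀ᶠ n in atTop, |∫ x, δ n x ∂(iid (Q n) n)
      - ∫ x, δ n x ∂(Measure.pi fun _ : Fin n => tilt (P : Measure Ω) e a n)| < ε := by
  have h := hQ.tendsto_integral_sub_tilt he he2 he0 hq hδ
  filter_upwards [(Metric.tendsto_nhds.1 h) ε hε] with n hn
  simpa [Real.dist_eq] using hn

lemma eventually_tilt_le_of_asympSize_le
    (hPn : ∀ ρ : Lp ℝ 2 (P : Measure Ω), ∫ x, ρ x ∂(P : Measure Ω) = 0 →
      IsLocalAlternative P ρ (Pn ρ)) (he : Measurable e)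
    (he2 : MemLp e 2 (P : Measure Ω)) (he0 : ∫ x, e x ∂(P : Measure Ω) = 0) {a α : ℝ}
    {q : Lp ℝ 2 (P : Measure Ω)} (hqG : q ∈ G) (hq0 : ∫ x, q x ∂(P : Measure Ω) = 0)
    (hq : ∀ᵐ x ∂(P : Measure Ω), q x = a * e x)
    {δ : ∀ n : ℕ, (Fin n → Ω) → ℝ} (hδ : IsAsymptoticTest δ) (hsize : asympSize Pn G δ ≤ α) :
    ∀ ε > 0, ∀ᶠ n in atTop,
      ∫ x, δ n x ∂(Measure.pi fun _ : Fin n => tilt (P : Measure Ω) e a n) ≤ α + ε := by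
  intro ε hε
  have h1 : limsup (fun n : ℕ => ∫ x, δ n x ∂(iid (Pn q n) n)) atTop < α + ε / 2 :=
    ((limsup_le_asympSize hδ hqG).trans hsize).trans_lt (by linarith)
  filter_upwards [eventually_lt_of_limsup_lt h1
      (isBoundedUnder_le_of_mem_Icc fun n => hδ.integral_mem_Icc _ n),
    (hPn q hq0).eventually_le_tilt he he2 he0 hq hδ (half_pos hε)] with n h2 h3
  rw [abs_lt] at h3
  linarith

lemma eventually_le_tilt_of_le_asympPower
    (hPn : ∀ ρ : Lp ℝ 2 (P : Measure Ω), ∫ x, ρ x ∂(P : Measure Ω) = 0 →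
      IsLocalAlternative P ρ (Pn ρ)) (he : Measurable e)
    (he2 : MemLp e 2 (P : Measure Ω)) (he0 : ∫ x, e x ∂(P : Measure Ω) = 0) {b β : ℝ}
    {q : Lp ℝ 2 (P : Measure Ω)} (hqG : q ∈ G) (hq0 : ∫ x, q x ∂(P : Measure Ω) = 0)
    (hq : ∀ᵐ x ∂(P : Measure Ω), q x = b * e x)
    {δ : ∀ n : ℕ, (Fin n → Ω) → ℝ} (hδ : IsAsymptoticTest δ) (hpower : β ≤ asympPower Pn G δ) :
    ∀ ε > 0, ∀ᶠ n in atTop,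
      β - ε ≤ ∫ x, δ n x ∂(Measure.pi fun _ : Fin n => tilt (P : Measure Ω) e b n) := by
  intro ε hε
  have h1 : β - ε / 2 < liminf (fun n : ℕ => ∫ x, δ n x ∂(iid (Pn q n) n)) atTop :=
    lt_of_lt_of_le (by linarith) (hpower.trans (asympPower_le_liminf hδ hqG))
  filter_upwards [eventually_lt_of_lt_liminf h1
      (isBoundedUnder_ge_of_mem_Icc fun n => hδ.integral_mem_Icc _ n),
    (hPn q hq0).eventually_le_tilt he he2 he0 hq hδ (half_pos hε)] with n h2 h3
  rw [abs_lt] at h3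
  linarith

/-- Maxmin property of the one-sided linear test. -/
theorem isMaxminTest_of_ae_eq
    (hPn : ∀ ρ : Lp ℝ 2 (P : Measure Ω), ∫ x, ρ x ∂(P : Measure Ω) = 0 →
      IsLocalAlternative P ρ (Pn ρ)) (he : Measurable e)
    (he2 : MemLp e 2 (P : Measure Ω)) (he0 : ∫ x, e x ∂(P : Measure Ω) = 0)
    (he1 : ∫ x, e x ^ 2 ∂(P : Measure Ω) = 1)
    (hG₀ : ∀ g ∈ G₀, ∫ x, g x ∂(P : Measure Ω) = 0) (hG₁ : ∀ g ∈ G₁, ∫ x, g x ∂(P : Measure Ω) = 0)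
    {a b c : ℝ} (hab : a < b) (ha : ∀ g ∈ G₀, ∫ x, g x * e x ∂(P : Measure Ω) ≤ a)
    (hb : ∀ g ∈ G₁, b ≤ ∫ x, g x * e x ∂(P : Measure Ω))
    {q₀ q₁ : Lp ℝ 2 (P : Measure Ω)} (hq₀ : q₀ ∈ G₀) (hq₁ : q₁ ∈ G₁)
    (hqe₀ : ∀ᵐ x ∂(P : Measure Ω), q₀ x = a * e x) (hqe₁ : ∀ᵐ x ∂(P : Measure Ω), q₁ x = b * e x)
    {ψ : ∀ n : ℕ, (Fin n → Ω) → ℝ} (hψ : IsAsymptoticTest ψ)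
    (hψe : ∀ n, ψ n =ᵐ[iid P n] thresholdTest (stdSum e) c n) :
    IsMaxminTest Pn G₀ G₁ (cdf (gaussianReal 0 1) (a - c)) ψ
      ∧ asympPower Pn G₁ ψ = cdf (gaussianReal 0 1) (b - c) := by
  have hlim : ∀ g : Lp ℝ 2 (P : Measure Ω), ∫ x, g x ∂(P : Measure Ω) = 0 →
      Tendsto (fun n => ∫ x, ψ n x ∂(iid (Pn g n) n)) atTop
        (𝓝 (cdf (gaussianReal 0 1) (∫ x, g x * e x ∂(P : Measure Ω) - c))) := fun g hg =>
    (hPn g hg).tendsto_integral hg he he2 he0 he1 hψ hψe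
  have hmono := monotone_cdf (gaussianReal 0 1)
  have : Nonempty G₀ := ⟨⟨q₀, hq₀⟩⟩
  have : Nonempty G₁ := ⟨⟨q₁, hq₁⟩⟩
  have heq₁ : ∫ x, q₁ x * e x ∂(P : Measure Ω) = b := by
    rw [integral_congr_ae (g := fun x => b * e x ^ 2) (hqe₁.mono fun x hx => by
      simp only [hx]; ring), integral_const_mul, he1, mul_one]
  have hpow : asympPower Pn G₁ ψ = cdf (gaussianReal 0 1) (b - c) := by
    refine le_antisymm ?_ (le_ciInf fun g => ?_)
    · refine (asympPower_le_liminf hψ hq₁).trans_eq ?_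
      rw [(hlim q₁ (hG₁ _ hq₁)).liminf_eq, heq₁]
    · rw [(hlim g (hG₁ _ g.2)).liminf_eq]
      exact hmono (by linarith [hb g g.2])
  refine ⟨⟨hψ, ciSup_le fun g => ?_, fun δ hδ hsize => ?_⟩, hpow⟩
  · rw [(hlim g (hG₀ _ g.2)).limsup_eq]
    exact hmono (by linarith [ha g g.2])
  · rw [hpow]
    refine le_of_forall_pos_le_add fun ε hε => ?_
    -- The competitor is tested only against the pair `q₀`, `q₁`. Both tangents are multiples of
    -- `e`, hence belong to one exponential family.
    have h1 := eventually_integral_le_of_level he he2 he0 he1 hab c hδ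
      (eventually_tilt_le_of_asympSize_le hPn he he2 he0 hq₀ (hG₀ _ hq₀) hqe₀ hδ hsize)
      (ε / 2) (half_pos hε)
    refine (asympPower_le_liminf hδ hq₁).trans ?_
    refine liminf_le_of_frequently_le (Eventually.frequently ?_)
      (isBoundedUnder_ge_of_mem_Icc fun n => hδ.integral_mem_Icc _ n)
    filter_upwards [h1, (hPn q₁ (hG₁ _ hq₁)).eventually_le_tilt he he2 he0 hqe₁ hδ (half_pos hε)]
      with n h2 h3
    rw [abs_lt] at h3
    linarith

end

/-! ### Scores have mean zero -/

/-- The left side is the total mass of `(1 + s ρ / 2) ^ 2 dP` minus that of `Q`. Both are squared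
norms of roots, and their difference is controlled by the distance of the roots. -/
lemma abs_integral_tangent_le (P Q : ProbabilityMeasure Ω) {ρ : Ω → ℝ} (hρ : Measurable ρ)
    (hρ2 : MemLp ρ 2 (P : Measure Ω)) (s : ℝ) (hfin : sqrtDefect P Q ρ s ≠ ∞) {κ : ℝ} (hκ : 0 < κ) :
    |s * ∫ x, ρ x ∂(P : Measure Ω) + s ^ 2 / 4 * ∫ x, ρ x ^ 2 ∂(P : Measure Ω)|
      ≤ (1 + κ⁻¹) * (sqrtDefect P Q ρ s).toReal
        + κ * (1 + s * ∫ x, ρ x ∂(P : Measure Ω) + s ^ 2 / 4 * ∫ x, ρ x ^ 2 ∂(P : Measure Ω)) := by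
  let μ : Measure Ω := (P : Measure Ω) + (Q : Measure Ω)
  have hPμ : (P : Measure Ω) ≪ μ := Measure.AbsolutelyContinuous.rfl.add_right _
  have hQμ : (Q : Measure Ω) ≪ μ := by
    simp only [μ]; rw [add_comm]; exact Measure.AbsolutelyContinuous.rfl.add_right _
  set p : Ω → ℝ := fun x => ((P : Measure Ω).rnDeriv μ x).toReal with hp
  set q : Ω → ℝ := fun x => ((Q : Measure Ω).rnDeriv μ x).toReal with hq
  have hpm : Measurable p := (Measure.measurable_rnDeriv _ _).ennreal_toReal
  have hqm : Measurable q := (Measure.measurable_rnDeriv _ _).ennreal_toReal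
  have hp0 : ∀ x, 0 ≤ p x := fun x => ENNReal.toReal_nonneg
  have hq0 : ∀ x, 0 ≤ q x := fun x => ENNReal.toReal_nonneg
  have hPd : μ.withDensity (fun x => ENNReal.ofReal (p x)) = P := withDensity_ofReal_rnDeriv hPμ
  have hqi : Integrable q μ := Measure.integrable_toReal_rnDeriv
  have hq1 : ∫ x, q x ∂μ = 1 := by
    rw [hq, Measure.integral_toReal_rnDeriv hQμ]; simp
  have hρi : Integrable ρ (P : Measure Ω) := hρ2.integrable (by norm_num)
  have hρi2 : Integrable (fun x => ρ x ^ 2) (P : Measure Ω) := hρ2.integrable_sq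
  have hV : ∀ x, (1 + 1 / 2 * s * ρ x) ^ 2 = 1 + s * ρ x + s ^ 2 / 4 * ρ x ^ 2 := fun x => by ring
  have h1s : Integrable (fun x => 1 + s * ρ x) (P : Measure Ω) :=
    (integrable_const 1).add (hρi.const_mul s)
  have hVi : Integrable (fun x => (1 + 1 / 2 * s * ρ x) ^ 2) (P : Measure Ω) := by
    simp_rw [hV]; exact h1s.add (hρi2.const_mul _)
  have hVe : ∫ x, (1 + 1 / 2 * s * ρ x) ^ 2 ∂(P : Measure Ω)
      = 1 + s * ∫ x, ρ x ∂(P : Measure Ω) + s ^ 2 / 4 * ∫ x, ρ x ^ 2 ∂(P : Measure Ω) := by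
    simp_rw [hV]
    rw [integral_add h1s (hρi2.const_mul _), integral_add (integrable_const _) (hρi.const_mul s),
      integral_const_mul, integral_const_mul]
    simp
  set v : Ω → ℝ := fun x => (1 + 1 / 2 * s * ρ x) * √(p x) with hv
  have hv2 : ∀ x, v x ^ 2 = p x * (1 + 1 / 2 * s * ρ x) ^ 2 := fun x => by
    simp only [hv]; rw [mul_pow, Real.sq_sqrt (hp0 x), mul_comm]
  have hvi : Integrable (fun x => v x ^ 2) μ := by
    simp_rw [hv2]
    rw [← hPd, integrable_withDensity_iff hpm.ennreal_ofReal (ae_of_all _ fun _ => by simp)] at hVi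
    simpa [ENNReal.toReal_ofReal, hp0, mul_comm] using hVi
  have hve : ∫ x, v x ^ 2 ∂μ
      = 1 + s * ∫ x, ρ x ∂(P : Measure Ω) + s ^ 2 / 4 * ∫ x, ρ x ^ 2 ∂(P : Measure Ω) := by
    rw [← hVe]
    simp_rw [hv2]
    rw [← integral_withDensity_ofReal hpm.aemeasurable hp0, hPd]
  have hvm : Measurable v := by simp only [hv]; fun_prop
  have hDi : Integrable (fun x => (√(q x) - v x) ^ 2) μ := by
    refine ⟨Measurable.aestronglyMeasurable (by fun_prop), ?_⟩
    rw [hasFiniteIntegral_iff_ofReal (ae_of_all _ fun x => by positivity)]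
    exact lt_top_iff_ne_top.2 hfin
  have hDe : (sqrtDefect P Q ρ s).toReal = ∫ x, (√(q x) - v x) ^ 2 ∂μ :=
    (integral_eq_lintegral_of_nonneg_ae (ae_of_all _ fun x => by positivity) hDi.1).symm
  have hmain : |∫ x, (q x - v x ^ 2) ∂μ|
      ≤ ∫ x, ((1 + κ⁻¹) * (√(q x) - v x) ^ 2 + κ * v x ^ 2) ∂μ := by
    refine (norm_integral_le_integral_norm (fun x => q x - v x ^ 2)).trans
      (integral_mono (hqi.sub hvi).norm ((hDi.const_mul _).add (hvi.const_mul _)) fun x => ?_)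
    simp only [Real.norm_eq_abs]
    have e1 : q x - v x ^ 2 = (√(q x) - v x) ^ 2 + 2 * v x * (√(q x) - v x) := by
      nlinarith [Real.sq_sqrt (hq0 x)]
    rw [e1]
    set w := √(q x) - v x
    have e2 : κ⁻¹ * w ^ 2 + κ * v x ^ 2 - 2 * v x * w = κ⁻¹ * (w - κ * v x) ^ 2 := by
      field_simp; ring
    have e3 : κ⁻¹ * w ^ 2 + κ * v x ^ 2 + 2 * v x * w = κ⁻¹ * (w + κ * v x) ^ 2 := by
      field_simp; ring
    have e4 : 0 ≤ κ⁻¹ * (w - κ * v x) ^ 2 := by positivity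
    have e5 : 0 ≤ κ⁻¹ * (w + κ * v x) ^ 2 := by positivity
    rw [abs_le]
    constructor <;> nlinarith [sq_nonneg w]
  rw [integral_sub hqi hvi, integral_add (hDi.const_mul _) (hvi.const_mul _), integral_const_mul,
    integral_const_mul, ← hDe, hve, hq1] at hmain
  rw [← abs_neg]
  convert hmain using 2
  ring

/-- Scores functions are centered. -/
theorem IsScore.integral_eq_zero {Θ : Set ℝ} (hΘ : IsOpen Θ) {M : Θ → ProbabilityMeasure Ω}
    {θ₀ : Θ} {Λ : Ω → ℝ} (h : IsScore M θ₀ Λ) : ∫ x, Λ x ∂(M θ₀ : Measure Ω) = 0 := by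
  -- Openness of `Θ` enters here: at an isolated parameter the limit along the punctured
  -- neighborhoods would say nothing.
  have hne : NeBot (𝓝[≠] θ₀) := by
    rw [neBot_iff, Ne, ← isOpen_singleton_iff_punctured_nhds]
    intro hs
    have h1 := hΘ.isOpenMap_subtype_val _ hs
    rw [Set.image_singleton] at h1
    exact not_isOpen_singleton (θ₀ : ℝ) h1
  set m := ∫ x, Λ x ∂(M θ₀ : Measure Ω)
  set I := ∫ x, Λ x ^ 2 ∂(M θ₀ : Measure Ω)
  have hI : 0 ≤ I := integral_nonneg fun x => sq_nonneg _
  set R : Θ → ℝ := fun θ => (sqrtDefect (M θ₀) (M θ) Λ ((θ : ℝ) - θ₀)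
      / ENNReal.ofReal (((θ : ℝ) - θ₀) ^ 2)).toReal with hR
  have hR0 : Tendsto R (𝓝[≠] θ₀) (𝓝 0) :=
    (ENNReal.tendsto_toReal ENNReal.zero_ne_top).comp h.tendsto
  have ht : Tendsto (fun θ : Θ => (θ : ℝ) - θ₀) (𝓝[≠] θ₀) (𝓝 0) := by
    have : Continuous fun θ : Θ => (θ : ℝ) - θ₀ := by fun_prop
    exact (this.tendsto' _ _ (by simp)).mono_left nhdsWithin_le_nhds
  suffices hle : ∀ η > 0, |m| ≤ 0 + η by
    exact abs_eq_zero.1 (le_antisymm (le_of_forall_pos_le_add hle) (abs_nonneg _))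
  intro η hη
  rw [zero_add]
  have hlim : Tendsto (fun θ : Θ => |(θ : ℝ) - θ₀| * I / 4 + R θ * |(θ : ℝ) - θ₀| + R θ * η⁻¹
      + η * (1 + ((θ : ℝ) - θ₀) * m + ((θ : ℝ) - θ₀) ^ 2 / 4 * I)) (𝓝[≠] θ₀) (𝓝 η) := by
    have h1 := ((ht.abs.mul_const I).div_const 4).add (hR0.mul ht.abs)
    have h2 := h1.add (hR0.mul_const η⁻¹)
    have h3 := (((tendsto_const_nhds (x := (1 : ℝ))).add (ht.mul_const m)).add
      (((ht.pow 2).div_const 4).mul_const I)).const_mul η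
    refine (h2.add h3).trans_eq ?_
    simp
  refine le_of_tendsto_of_tendsto tendsto_const_nhds hlim ?_
  filter_upwards [self_mem_nhdsWithin, h.tendsto.eventually (gt_mem_nhds ENNReal.zero_lt_top)]
    with θ hθ hfin
  set t := (θ : ℝ) - θ₀ with htdef
  have ht0 : t ≠ 0 := sub_ne_zero.2 fun h => hθ (Subtype.ext h)
  have ht2 : 0 < t ^ 2 := by positivity
  have habs : 0 < |t| := abs_pos.2 ht0
  have hD : sqrtDefect (M θ₀) (M θ) Λ t ≠ ∞ := by
    intro hD
    rw [hD, ENNReal.top_div_of_ne_top ENNReal.ofReal_ne_top] at hfin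
    exact lt_irrefl _ hfin
  have hRD : (sqrtDefect (M θ₀) (M θ) Λ t).toReal = R θ * t ^ 2 := by
    simp only [hR]
    rw [ENNReal.toReal_div, ENNReal.toReal_ofReal ht2.le, div_mul_cancel₀ _ ht2.ne']
  -- With `κ = |t| η` every term carries a factor `|t|`, which cancels against `|t| * |m|`; only `η`
  -- survives in the limit.
  have hb := abs_integral_tangent_le (M θ₀) (M θ) h.measurable h.memLp t hD
    (κ := |t| * η) (by positivity)
  rw [hRD] at hb
  have h1 : |t| * |m| ≤ |t * m + t ^ 2 / 4 * I| + t ^ 2 / 4 * I := by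
    rw [← abs_mul]
    have := abs_sub_abs_le_abs_sub (t * m) (-(t ^ 2 / 4 * I))
    rw [abs_neg, abs_of_nonneg (show 0 ≤ t ^ 2 / 4 * I by positivity), sub_neg_eq_add] at this
    linarith
  have h2 : |t| * |m| ≤ |t| * (|t| * I / 4 + R θ * |t| + R θ * η⁻¹
      + η * (1 + t * m + t ^ 2 / 4 * I)) := by
    refine h1.trans ((add_le_add_left hb _).trans_eq ?_)
    have e : t ^ 2 = |t| * |t| := by rw [← sq, sq_abs]
    rw [mul_inv, e]
    field_simp
    ring
  exact le_of_mul_le_mul_left h2 habs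

/-! ### Geometry of least favorable pairs -/

section Geometry
variable {E : Type*} [NormedAddCommGroup E] [InnerProductSpace ℝ E]

/-- Equality case of Cauchy-Schwarz, seen by expanding the squared norm of the difference of the two
sides. -/
lemma eq_smul_of_inner_ge {L x : E} (hL : 0 < ‖L‖) {R : ℝ} (hx : ‖x‖ ≤ R)
    (h : R * ‖L‖ ≤ inner ℝ L x) : x = (R * ‖L‖⁻¹) • L := by
  have hR : 0 ≤ R := (norm_nonneg x).trans hx
  rw [← sub_eq_zero, ← norm_eq_zero, ← sq_eq_zero_iff]
  refine le_antisymm ?_ (sq_nonneg _)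
  rw [norm_sub_sq_real, inner_smul_right, norm_smul, Real.norm_of_nonneg (by positivity),
    show R * ‖L‖⁻¹ * ‖L‖ = R by field_simp, real_inner_comm]
  have h1 : ‖x‖ ^ 2 ≤ R ^ 2 := by gcongr
  have h2 := mul_le_mul_of_nonneg_left h (show 0 ≤ R * ‖L‖⁻¹ by positivity)
  have h3 : R * ‖L‖⁻¹ * (R * ‖L‖) = R ^ 2 := by field_simp
  linarith

lemma sub_le_norm_smul_add_sub {L x y : E} {τ R S : ℝ} (hτ : 0 ≤ τ)
    (hx : ‖x‖ ≤ R) (hy : ‖y‖ ≤ S) : τ * ‖L‖ - (R + S) ≤ ‖τ • L + y - x‖ := by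
  have h1 : ‖τ • L‖ ≤ ‖τ • L + y - x‖ + ‖x - y‖ := by
    have := norm_add_le (τ • L + y - x) (x - y)
    simpa using this
  rw [norm_smul, Real.norm_of_nonneg hτ] at h1
  linarith [norm_sub_le x y]

/-- Pairing the short difference with `L` forces `⟨L, x⟩` and `⟨L, -y⟩` to attain their
Cauchy-Schwarz bounds `R ‖L‖` and `S ‖L‖` together. -/
lemma eq_of_norm_smul_add_sub_le {L x y : E} (hL : 0 < ‖L‖) {τ R S : ℝ}
    (hx : ‖x‖ ≤ R) (hy : ‖y‖ ≤ S) (h : ‖τ • L + y - x‖ ≤ τ * ‖L‖ - (R + S)) :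
    x = (R * ‖L‖⁻¹) • L ∧ y = -((S * ‖L‖⁻¹) • L) := by
  have h1 := (real_inner_le_norm L (τ • L + y - x)).trans (mul_le_mul_of_nonneg_left h hL.le)
  rw [inner_sub_right, inner_add_right, inner_smul_right, real_inner_self_eq_norm_sq] at h1
  have h2 := (real_inner_le_norm L x).trans (mul_le_mul_of_nonneg_left hx hL.le)
  have hy' : ‖-y‖ ≤ S := by rwa [norm_neg]
  have h3 := (real_inner_le_norm L (-y)).trans (mul_le_mul_of_nonneg_left hy' hL.le)
  rw [inner_neg_right] at h3
  refine ⟨eq_smul_of_inner_ge hL hx (by nlinarith), ?_⟩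
  rw [← eq_smul_of_inner_ge hL hy' (by rw [inner_neg_right]; nlinarith), neg_neg]

end Geometry

section HellingerGeometry
variable {P : ProbabilityMeasure Ω}

lemma integral_mul_eq_inner (f g : Lp ℝ 2 (P : Measure Ω)) :
    ∫ x, f x * g x ∂(P : Measure Ω) = inner ℝ f g := by
  rw [L2.inner_def]
  exact integral_congr_ae (ae_of_all _ fun x => by simp [mul_comm])

lemma integral_sq_eq_norm_sq (g : Lp ℝ 2 (P : Measure Ω)) :
    ∫ x, g x ^ 2 ∂(P : Measure Ω) = ‖g‖ ^ 2 := by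
  rw [← real_inner_self_eq_norm_sq, ← integral_mul_eq_inner]
  simp_rw [sq]

lemma integral_coe_smul (c : ℝ) (g : Lp ℝ 2 (P : Measure Ω)) :
    ∫ x, (c • g : Lp ℝ 2 (P : Measure Ω)) x ∂(P : Measure Ω) = c * ∫ x, g x ∂(P : Measure Ω) := by
  rw [integral_congr_ae (Lp.coeFn_smul c g)]
  exact integral_const_mul c _

lemma integral_coe_add (f g : Lp ℝ 2 (P : Measure Ω)) :
    ∫ x, (f + g : Lp ℝ 2 (P : Measure Ω)) x ∂(P : Measure Ω)
      = ∫ x, f x ∂(P : Measure Ω) + ∫ x, g x ∂(P : Measure Ω) := by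
  rw [integral_congr_ae (Lp.coeFn_add f g)]
  exact integral_add ((Lp.memLp f).integrable (by norm_num)) ((Lp.memLp g).integrable (by norm_num))

lemma mem_hellingerBall_iff {g : Lp ℝ 2 (P : Measure Ω)} :
    g ∈ hellingerBall P ↔ ∫ x, g x ∂(P : Measure Ω) = 0 ∧ ‖g‖ ≤ √8 := by
  rw [hellingerBall, Set.mem_ofPred_eq, integral_sq_eq_norm_sq, Real.le_sqrt (norm_nonneg _) (by norm_num)]

lemma norm_smul_le_of_mem_hellingerBall {g : Lp ℝ 2 (P : Measure Ω)} (hg : g ∈ hellingerBall P)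
    {r : ℝ} (hr : 0 ≤ r) : ‖r • g‖ ≤ r * √8 := by
  rw [norm_smul, Real.norm_of_nonneg hr]
  exact mul_le_mul_of_nonneg_left (mem_hellingerBall_iff.1 hg).2 hr

lemma smul_mem_hellingerBall {L : Lp ℝ 2 (P : Measure Ω)} (hL : 0 < ‖L‖)
    (hL0 : ∫ x, L x ∂(P : Measure Ω) = 0) {c : ℝ} (hc : |c| = √8 * ‖L‖⁻¹) :
    c • L ∈ hellingerBall P := by
  rw [mem_hellingerBall_iff, integral_coe_smul, hL0, mul_zero, norm_smul, Real.norm_eq_abs, hc,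
    mul_assoc, inv_mul_cancel₀ hL.ne', mul_one]
  exact ⟨rfl, le_rfl⟩

lemma integral_eq_zero_of_mem_hellingerNull {r : ℝ} {g : Lp ℝ 2 (P : Measure Ω)}
    (hg : g ∈ hellingerNull P r) : ∫ x, g x ∂(P : Measure Ω) = 0 := by
  obtain ⟨h, hh, rfl⟩ := hg
  simp only [integral_coe_smul, (mem_hellingerBall_iff.1 hh).1, mul_zero]

lemma integral_eq_zero_of_mem_hellingerAlt {r τ : ℝ} {L g : Lp ℝ 2 (P : Measure Ω)}
    (hL0 : ∫ x, L x ∂(P : Measure Ω) = 0) (hg : g ∈ hellingerAlt P L τ r) :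
    ∫ x, g x ∂(P : Measure Ω) = 0 := by
  obtain ⟨h, hh, rfl⟩ := hg
  simp only [integral_coe_add, integral_coe_smul, (mem_hellingerBall_iff.1 hh).1, hL0, mul_zero,
    add_zero]

variable {L : Lp ℝ 2 (P : Measure Ω)} {r₀ r₁ τ : ℝ}

lemma smul_mem_hellingerNull (hL : 0 < ‖L‖) (hL0 : ∫ x, L x ∂(P : Measure Ω) = 0) :
    (r₀ * (√8 * ‖L‖⁻¹)) • L ∈ hellingerNull P r₀ :=
  ⟨(√8 * ‖L‖⁻¹) • L, smul_mem_hellingerBall hL hL0 (abs_of_nonneg (by positivity)), smul_smul _ _ _⟩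

lemma smul_sub_smul_mem_hellingerAlt (hL : 0 < ‖L‖) (hL0 : ∫ x, L x ∂(P : Measure Ω) = 0) :
    τ • L - (r₁ * (√8 * ‖L‖⁻¹)) • L ∈ hellingerAlt P L τ r₁ :=
  ⟨(-(√8 * ‖L‖⁻¹)) • L,
    smul_mem_hellingerBall hL hL0 (by rw [abs_neg, abs_of_nonneg (by positivity)]), by
    simp only [neg_smul, smul_neg, smul_smul, sub_eq_add_neg]⟩

/-- The least favorable tangent pair between Hellinger balls. -/
theorem isLeastFavorable_hellinger_iff (hL : 0 < ‖L‖) (hL0 : ∫ x, L x ∂(P : Measure Ω) = 0)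
    (hr₀ : 0 ≤ r₀) (hr₁ : 0 ≤ r₁) (hτ : 0 ≤ τ) (hsep : √8 * (r₀ + r₁) < τ * ‖L‖)
    (g : Lp ℝ 2 (P : Measure Ω) × Lp ℝ 2 (P : Measure Ω)) :
    IsLeastFavorable (hellingerNull P r₀) (hellingerAlt P L τ r₁) g
      ↔ g = ((r₀ * (√8 * ‖L‖⁻¹)) • L, τ • L - (r₁ * (√8 * ‖L‖⁻¹)) • L) := by
  have hq : ‖(τ • L - (r₁ * (√8 * ‖L‖⁻¹)) • L) - (r₀ * (√8 * ‖L‖⁻¹)) • L‖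
      = τ * ‖L‖ - (r₀ * √8 + r₁ * √8) := by
    have e : τ * ‖L‖ - (r₀ * √8 + r₁ * √8)
        = (τ - r₁ * (√8 * ‖L‖⁻¹) - r₀ * (√8 * ‖L‖⁻¹)) * ‖L‖ := by field_simp; ring
    have hpos : 0 ≤ τ - r₁ * (√8 * ‖L‖⁻¹) - r₀ * (√8 * ‖L‖⁻¹) := by
      refine nonneg_of_mul_nonneg_left (b := ‖L‖) ?_ hL
      rw [← e]; linarith
    rw [← sub_smul, ← sub_smul, norm_smul, Real.norm_of_nonneg hpos, e]
  constructor
  · rintro ⟨h0, h1, hmin⟩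
    have h2 := hmin _ (smul_mem_hellingerNull hL hL0) _ (smul_sub_smul_mem_hellingerAlt hL hL0)
    rw [hq] at h2
    obtain ⟨x, hx, hx'⟩ := h0
    obtain ⟨y, hy, hy'⟩ := h1
    rw [← hx', ← hy'] at h2
    obtain ⟨h3, h4⟩ := eq_of_norm_smul_add_sub_le hL (norm_smul_le_of_mem_hellingerBall hx hr₀)
      (norm_smul_le_of_mem_hellingerBall hy hr₁) h2
    refine Prod.ext ?_ ?_
    · rw [← hx', ← mul_assoc]; exact h3
    · simp only [← hy', sub_eq_add_neg, ← mul_assoc, ← h4]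
  · rintro rfl
    refine ⟨smul_mem_hellingerNull hL hL0, smul_sub_smul_mem_hellingerAlt hL hL0, ?_⟩
    rintro _ ⟨x, hx, rfl⟩ _ ⟨y, hy, rfl⟩
    rw [hq]
    exact sub_le_norm_smul_add_sub hτ (norm_smul_le_of_mem_hellingerBall hx hr₀)
      (norm_smul_le_of_mem_hellingerBall hy hr₁)

end HellingerGeometry

/-! ### The pair test and the score test as threshold tests -/

lemma isAsymptoticTest_pairTest {P : ProbabilityMeasure Ω} (u : ℝ)
    (g : Lp ℝ 2 (P : Measure Ω) × Lp ℝ 2 (P : Measure Ω)) : IsAsymptoticTest (pairTest u g) where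
  measurable n := by
    have hm : Measurable (g.2 - g.1 : Lp ℝ 2 (P : Measure Ω)) :=
      (Lp.stronglyMeasurable (g.2 - g.1)).measurable
    exact Measurable.ite (measurableSet_lt measurable_const (by fun_prop)) measurable_const
      measurable_const
  mem_Icc n x := by unfold pairTest; split_ifs <;> simp

lemma scoreTest_eq_thresholdTest {Ω : Type*} (Λ : Ω → ℝ) {N : ℝ} (hN : 0 ≤ N) (u r₀ : ℝ) :
    scoreTest Λ (N ^ 2) u r₀ = thresholdTest (stdSum fun x => Λ x / N) (u + √8 * r₀) := by
  ext n x
  have e : 1 / √(n * N ^ 2) * ∑ i, Λ (x i) = stdSum (fun x => Λ x / N) n x := by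
    rw [stdSum, ← Finset.sum_div, Real.sqrt_mul (Nat.cast_nonneg n), Real.sqrt_sq hN, one_div, mul_inv]
    ring
  simp only [scoreTest, thresholdTest, e, gt_iff_lt]

/-- The positive factor `d * N` cancels from statistic and cutoff. Equality is only almost sure
because the pair test uses a representative of an `L₂` class. -/
lemma pairTest_ae_eq_thresholdTest {P : ProbabilityMeasure Ω} {Λ : Ω → ℝ}
    {g : Lp ℝ 2 (P : Measure Ω) × Lp ℝ 2 (P : Measure Ω)} {d u c N : ℝ} (hd : 0 < d) (hN : 0 < N)
    (hg : ∀ᵐ x ∂(P : Measure Ω), (g.2 - g.1 : Lp ℝ 2 (P : Measure Ω)) x = d * Λ x)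
    (hc : ‖g.2 - g.1‖ * u + inner ℝ (g.2 - g.1) g.1 = d * N * c) (n : ℕ) :
    pairTest u g n =ᵐ[iid P n] thresholdTest (stdSum fun x => Λ x / N) c n := by
  have hall : ∀ᵐ x ∂(iid P n), ∀ i, (g.2 - g.1 : Lp ℝ 2 (P : Measure Ω)) (x i) = d * Λ (x i) :=
    ae_all_iff.2 fun i =>
      (Measure.quasiMeasurePreserving_eval (fun _ : Fin n => (P : Measure Ω)) i).ae hg
  filter_upwards [hall] with x hx
  have e : 1 / √(n : ℝ) * ∑ i, (g.2 - g.1 : Lp ℝ 2 (P : Measure Ω)) (x i)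
      = d * N * stdSum (fun x => Λ x / N) n x := by
    simp only [hx]
    rw [stdSum, ← Finset.sum_div, ← Finset.mul_sum]
    field_simp
  simp only [pairTest, thresholdTest, e, hc, gt_iff_lt, mul_lt_mul_iff_right₀ (mul_pos hd hN)]

end TangentTests

end

/-! ### Specialization to the unit score -/

theorem theorem8p4 {Ω : Type*} [MeasurableSpace Ω]
    -- the smooth one parameter ideal model, the fixed parameter and its scores function
    (Θ : Set ℝ) (_hΘ : IsOpen Θ) (M : Θ → ProbabilityMeasure Ω) (θ₀ : Θ)
    (Λ : Ω → ℝ) (hΛ : IsScore M θ₀ Λ)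
    -- local alternatives of `P = M θ₀`, one sequence for every tangent
    (Pn : Lp ℝ 2 (M θ₀ : Measure Ω) → ℕ → ProbabilityMeasure Ω)
    (hPn : ∀ ρ : Lp ℝ 2 (M θ₀ : Measure Ω), ∫ x, ρ x ∂(M θ₀ : Measure Ω) = 0 →
      IsLocalAlternative (M θ₀) ρ (Pn ρ))
    -- the level and the upper `α` point of the standard normal distribution
    (α u : ℝ) (hα : α ∈ Set.Ioo (0 : ℝ) 1) (hu : cdf (gaussianReal 0 1) (-u) = α)
    (r₀ r₁ τ : ℝ) (hr₀ : 0 ≤ r₀) (hr₁ : 0 ≤ r₁) (hτ : 0 ≤ τ)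
    (h : 8 * (r₀ + r₁) ^ 2 < τ ^ 2 * ‖hΛ.toL2‖ ^ 2) :
    let G₀ := hellingerNull (M θ₀) r₀
    let G₁ := hellingerAlt (M θ₀) hΛ.toL2 τ r₁
    let γ : ℝ := √8 * ‖hΛ.toL2‖⁻¹
    let q : Lp ℝ 2 (M θ₀ : Measure Ω) × Lp ℝ 2 (M θ₀ : Measure Ω) :=
      ((r₀ * γ) • hΛ.toL2, τ • hΛ.toL2 - (r₁ * γ) • hΛ.toL2)
    let δ : ∀ n : ℕ, (Fin n → Ω) → ℝ := scoreTest Λ (‖hΛ.toL2‖ ^ 2) u r₀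
    let β : ℝ := cdf (gaussianReal 0 1) (-u + τ * ‖hΛ.toL2‖ - √8 * (r₀ + r₁))
    -- `q` is the unique least favorable tangent pair
    (∀ g, IsLeastFavorable G₀ G₁ g ↔ g = q) ∧
    -- the test `δ_q` is given by `δ`
    (∀ n : ℕ, pairTest u q n =ᵐ[iid (M θ₀) n] δ n) ∧
    -- it is maxmin, with the stated maxmin asymptotic power
    (IsMaxminTest Pn G₀ G₁ α (pairTest u q) ∧ asympPower Pn G₁ (pairTest u q) = β) ∧
    (IsMaxminTest Pn G₀ G₁ α δ ∧ asympPower Pn G₁ δ = β) ∧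
    -- and every maxmin test agrees with it up to terms tending to 0 in `P^n` probability
    (∀ δ', IsMaxminTest Pn G₀ G₁ α δ' → ∀ ε > 0,
      Tendsto (fun n : ℕ => iid (M θ₀) n {x | ε ≤ |δ' n x - δ n x|}) atTop (𝓝 0)) := by
  intro G₀ G₁ γ q δ β
  set L := hΛ.toL2
  -- A vanishing score would turn the right side of `h` into zero.
  have hN : 0 < ‖L‖ := by
    refine lt_of_le_of_ne (norm_nonneg _) fun h0 => ?_
    rw [← h0] at h
    nlinarith [sq_nonneg (r₀ + r₁)]
  have hγ : γ * ‖L‖ = √8 := by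
    change √8 * ‖L‖⁻¹ * ‖L‖ = √8
    field_simp
  have hsep : √8 * (r₀ + r₁) < τ * ‖L‖ := by
    refine lt_of_pow_lt_pow_left₀ 2 (by positivity) ?_
    rw [mul_pow, mul_pow, Real.sq_sqrt (by norm_num)]
    exact h
  have hLΛ : ∀ᵐ x ∂(M θ₀ : Measure Ω), L x = Λ x := hΛ.memLp.coeFn_toLp
  have hΛ0 : ∫ x, Λ x ∂(M θ₀ : Measure Ω) = 0 := hΛ.integral_eq_zero _hΘ
  have hL0 : ∫ x, L x ∂(M θ₀ : Measure Ω) = 0 := by rw [integral_congr_ae hLΛ, hΛ0]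
  set e : Ω → ℝ := fun x => Λ x / ‖L‖ with he
  have hem : Measurable e := hΛ.measurable.div_const _
  have he2 : MemLp e 2 (M θ₀ : Measure Ω) := by
    simpa [he, div_eq_mul_inv] using hΛ.memLp.mul_const ‖L‖⁻¹
  have he0 : ∫ x, e x ∂(M θ₀ : Measure Ω) = 0 := by simp only [he]; rw [integral_div, hΛ0, zero_div]
  have hin : ∀ g : Lp ℝ 2 (M θ₀ : Measure Ω), ∫ x, g x * e x ∂(M θ₀ : Measure Ω) = inner ℝ g L / ‖L‖ := by
    intro g
    rw [← integral_mul_eq_inner, ← integral_div]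
    refine integral_congr_ae (hLΛ.mono fun x hx => ?_)
    simp only [he, hx]; ring
  have he1 : ∫ x, e x ^ 2 ∂(M θ₀ : Measure Ω) = 1 := by
    have : ∫ x, e x ^ 2 ∂(M θ₀ : Measure Ω) = ∫ x, L x ^ 2 / ‖L‖ ^ 2 ∂(M θ₀ : Measure Ω) :=
      integral_congr_ae (hLΛ.mono fun x hx => by simp only [he, hx, div_pow])
    rw [this, integral_div, integral_sq_eq_norm_sq, div_self (by positivity)]
  have hball : ∀ {r : ℝ}, 0 ≤ r → ∀ g ∈ hellingerBall (M θ₀), |inner ℝ (r • g) L / ‖L‖| ≤ r * √8 := by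
    intro r hr g hg
    rw [abs_div, abs_norm, div_le_iff₀ hN]
    exact (abs_real_inner_le_norm _ _).trans (mul_le_mul_of_nonneg_right
      (norm_smul_le_of_mem_hellingerBall hg hr) (norm_nonneg _))
  have ha : ∀ g ∈ G₀, ∫ x, g x * e x ∂(M θ₀ : Measure Ω) ≤ r₀ * √8 := by
    rintro _ ⟨g, hg, rfl⟩
    rw [hin]
    exact (abs_le.1 (hball hr₀ g hg)).2
  have hb : ∀ g ∈ G₁, τ * ‖L‖ - r₁ * √8 ≤ ∫ x, g x * e x ∂(M θ₀ : Measure Ω) := by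
    rintro _ ⟨g, hg, rfl⟩
    rw [hin, inner_add_left, real_inner_smul_left, real_inner_self_eq_norm_sq, add_div]
    have h1 := (abs_le.1 (hball hr₁ g hg)).1
    have h2 : τ * ‖L‖ ^ 2 / ‖L‖ = τ * ‖L‖ := by field_simp
    linarith
  have hG₀ : ∀ g ∈ G₀, ∫ x, g x ∂(M θ₀ : Measure Ω) = 0 := fun g hg =>
    integral_eq_zero_of_mem_hellingerNull hg
  have hG₁ : ∀ g ∈ G₁, ∫ x, g x ∂(M θ₀ : Measure Ω) = 0 := fun g hg =>
    integral_eq_zero_of_mem_hellingerAlt hL0 hg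
  have hq₀ : q.1 ∈ G₀ := smul_mem_hellingerNull hN hL0
  have hq₁ : q.2 ∈ G₁ := smul_sub_smul_mem_hellingerAlt hN hL0
  have hscale : ∀ k : ℝ, ∀ᵐ x ∂(M θ₀ : Measure Ω),
      (k • L : Lp ℝ 2 (M θ₀ : Measure Ω)) x = k * ‖L‖ * e x := by
    intro k
    filter_upwards [Lp.coeFn_smul k L, hLΛ] with x h1 h2
    rw [h1, Pi.smul_apply, h2, smul_eq_mul]
    simp only [he]
    field_simp
  have hqe₀ : ∀ᵐ x ∂(M θ₀ : Measure Ω), q.1 x = r₀ * √8 * e x := by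
    filter_upwards [hscale (r₀ * γ)] with x hx
    refine hx.trans ?_
    rw [← hγ]; ring
  have hq₁' : q.2 = (τ - r₁ * γ) • L := (sub_smul _ _ _).symm
  have hqe₁ : ∀ᵐ x ∂(M θ₀ : Measure Ω), q.2 x = (τ * ‖L‖ - r₁ * √8) * e x := by
    rw [hq₁']
    filter_upwards [hscale (τ - r₁ * γ)] with x hx
    rw [hx, ← hγ]; ring
  have hqd : q.2 - q.1 = (τ - r₁ * γ - r₀ * γ) • L := by rw [hq₁', ← sub_smul]
  have hd : 0 < τ - r₁ * γ - r₀ * γ := by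
    refine pos_of_mul_pos_left (b := ‖L‖) ?_ hN.le
    have : (τ - r₁ * γ - r₀ * γ) * ‖L‖ = τ * ‖L‖ - √8 * (r₀ + r₁) := by
      rw [← hγ]; ring
    rw [this]; linarith
  have hδ : δ = thresholdTest (stdSum e) (u + √8 * r₀) := scoreTest_eq_thresholdTest Λ hN.le u r₀
  have hpair : ∀ n : ℕ, pairTest u q n =ᵐ[iid (M θ₀) n] thresholdTest (stdSum e) (u + √8 * r₀) n := by
    refine pairTest_ae_eq_thresholdTest hd hN ?_ ?_
    · rw [hqd]
      filter_upwards [hscale (τ - r₁ * γ - r₀ * γ)] with x hx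
      rw [hx]; simp only [he]; field_simp
    -- As `q.2 - q.1` and `q.1` are parallel, `⟨q₁₀|q₀⟩ = ‖q₁₀‖ √8 r₀`; this produces the cutoff `u
    -- + √8 r₀`.
    · have e1 : q.1 = (r₀ * γ) • L := rfl
      rw [hqd, e1, norm_smul, Real.norm_of_nonneg hd.le, real_inner_smul_left, real_inner_smul_right,
        real_inner_self_eq_norm_sq]
      rw [← hγ]; ring
  have hab : r₀ * √8 < τ * ‖L‖ - r₁ * √8 := by linarith
  have hα : cdf (gaussianReal 0 1) (r₀ * √8 - (u + √8 * r₀)) = α := by rw [← hu]; congr 1; ring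
  have hβ : cdf (gaussianReal 0 1) (τ * ‖L‖ - r₁ * √8 - (u + √8 * r₀)) = β := by
    simp only [β]; congr 1; ring
  have hmax : ∀ ψ : ∀ n : ℕ, (Fin n → Ω) → ℝ, IsAsymptoticTest ψ →
      (∀ n, ψ n =ᵐ[iid (M θ₀) n] thresholdTest (stdSum e) (u + √8 * r₀) n) →
      IsMaxminTest Pn G₀ G₁ α ψ ∧ asympPower Pn G₁ ψ = β := by
    intro ψ hψ hψe
    rw [← hα, ← hβ]
    exact isMaxminTest_of_ae_eq hPn hem he2 he0 he1 hG₀ hG₁ hab ha hb hq₀ hq₁ hqe₀ hqe₁ hψ hψe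
  have hδmax : IsMaxminTest Pn G₀ G₁ α δ ∧ asympPower Pn G₁ δ = β := by
    rw [hδ]
    exact hmax _ (isAsymptoticTest_thresholdTest (fun n => measurable_stdSum hem n) _)
      fun n => EventuallyEq.rfl
  refine ⟨isLeastFavorable_hellinger_iff hN hL0 hr₀ hr₁ hτ hsep, ?_,
    hmax _ (isAsymptoticTest_pairTest u q) hpair, hδmax, fun δ' hδ' ε hε => ?_⟩
  · rw [hδ]; exact hpair
  · rw [hδ]
    refine tendsto_measure_sub_thresholdTest hem he2 he0 he1 hab _ hδ'.isTest ?_ ?_ hε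
    · rw [hα]
      exact eventually_tilt_le_of_asympSize_le hPn hem he2 he0 hq₀ (hG₀ _ hq₀) hqe₀ hδ'.isTest
        hδ'.level
    -- Maximality of `δ'` compared with `δ` shows that its minimum power is at least `β`.
    · rw [hβ]
      refine eventually_le_tilt_of_le_asympPower hPn hem he2 he0 hq₁ (hG₁ _ hq₁) hqe₁ hδ'.isTest ?_
      rw [← hδmax.2]
      exact hδ'.maximal _ hδmax.1.isTest hδmax.1.level
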